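/- Let $0<s<r<1$. A packing is a set of interior-disjoint discs in the plane; it is compact if its contact graph (vertices: the disc centers; edges: the segments joining the centers of tangent discs) is triangulated, i.e. every point of the plane off the graph lies in a triangular face, whose vertices are the centers of three mutually tangent discs. Discs of radius $1$, $r$, $s$ are called large (1), medium (r), small (s). The corona of a disc in a packing is the set of discs tangent to it; it is coded by a circular word over $\{1,\mathrm r,\mathrm s\}$ giving the sizes of these discs, two letters being neighbors if and only if the corresponding discs are tangent. A small corona is the corona of a small disc. For a letter $x$ write also $x$ for the corresponding radius, and let $\widehat{xsy}$ be the angle at the center of the disc of radius $s$ in the triangle joining the centers of pairwise tangent discs of radii $x,s,y$. The equation of the small corona $x_1\cdots x_k$ is $\sum_{i}\widehat{x_i s x_{i+1}}=2\pi$ (indices modulo $k$). (1) There is exactly one pair $(r,s)$ with $0<s<r<1$ which satisfies the equations of both small coronas 1srrs and 1s1ss, namely $2\,\widehat{1ss}+2\,\widehat{rss}+\widehat{rsr}=2\pi$ and $4\,\widehat{1ss}+\widehat{sss}=2\pi$. (2) For all $0<s<r<1$, no compact packing by discs of radii $1$, $r$, $s$ contains both the small corona 1srrs and the small corona 1s1ss.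 (3) For the pair $(r,s)$ of (1), let a compact packing by discs with radii in $\{1,r,s\}$ (not all of which need occur) contain the small corona 1s1ss. Then the centers of its large discs form a triangular grid; every large disc has corona $\mathrm s^{12}$ ($12$ small discs); every other disc is a small disc tangent to a large one; in particular there is no medium disc. -/

import Mathlib

namespace DiscPacking

/-- A disc of the Euclidean plane (identified with `ℂ`), given by its center and its radius. -/
structure Disc where
  center : ℂ
  radius : ℝ
  radius_pos : 0 < radius

/-- Two discs are (externally) tangent. -/
def Disc.Tangent (d e : Disc) : Prop :=
  dist d.center e.center = d.radius + e.radius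

/-- A packing: a set of interior-disjoint discs. -/
def IsPacking (P : Set Disc) : Prop :=
  P.Pairwise fun d e =>
    Disjoint (Metric.ball d.center d.radius) (Metric.ball e.center e.radius)

/-- The contact graph of `P`, drawn in the plane: its vertices are the centers of the discs, and
its edges are the segments which connect the centers of mutually tangent discs. -/
def contactGraph (P : Set Disc) : Set ℂ :=
  {x | ∃ d ∈ P, x = d.center} ∪
    {x | ∃ d ∈ P, ∃ e ∈ P, d.Tangent e ∧ x ∈ segment ℝ d.center e.center}

/-- The set `F` is a triangular face of the drawn contact graph: it is the interior of the triangle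
which connects the centers of three mutually tangent discs of `P`, and it meets no vertex and no
edge of the graph. -/
def IsTriangularFace (P : Set Disc) (F : Set ℂ) : Prop :=
  ∃ d ∈ P, ∃ e ∈ P, ∃ f ∈ P, d.Tangent e ∧ e.Tangent f ∧ f.Tangent d ∧
    F = interior (convexHull ℝ {d.center, e.center, f.center}) ∧
    Disjoint F (contactGraph P)

/-- A compact packing (of the whole plane): a packing whose contact graph is triangulated, that is,
every point of the plane off the drawn contact graph lies in a triangular face. -/
def IsCompactPacking (P : Set Disc) : Prop :=
  IsPacking P ∧ ∀ x : ℂ, x ∉ contactGraph P → ∃ F, IsTriangularFace P F ∧ x ∈ F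

/-- The alphabet `{1, r, s}` of disc sizes. -/
inductive Size where
  | large
  | medium
  | small

/-- The radius of a disc of the given size: `1`, `r` or `s`. -/
def Size.radius (r s : ℝ) : Size → ℝ
  | .large => 1
  | .medium => r
  | .small => s

/-- Every disc of `P` has radius `1`, `r` or `s`. -/
def HasSizes (r s : ℝ) (P : Set Disc) : Prop :=
  ∀ d ∈ P, ∃ x : Size, d.radius = x.radius r s

/-- The word `w` is a coding of the corona of `d` in `P`: the letters of `w` correspond
bijectively to the discs of `P` tangent to `d` and give their sizes, and two letters are neighbors
in the circular word `w` if and only if the corresponding discs are tangent. -/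
def HasCorona (r s : ℝ) (P : Set Disc) (d : Disc) (w : List Size) : Prop :=
  ∃ f : Fin w.length → Disc, Function.Injective f ∧
    Set.range f = {e | e ∈ P ∧ d.Tangent e} ∧
    (∀ i, (f i).radius = (w.get i).radius r s) ∧
    ∀ i j, i ≠ j → ((f i).Tangent (f j) ↔
      (i.val + 1) % w.length = j.val ∨ (j.val + 1) % w.length = i.val)

/-- The packing `P` contains the small corona coded by `w`. -/
def ContainsSmallCorona (r s : ℝ) (P : Set Disc) (w : List Size) : Prop :=
  ∃ d ∈ P, d.radius = s ∧ HasCorona r s P d w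

/-- For pairwise tangent discs of radii `x`, `y`, `z`, the angle at the center of the disc of
radius `y` in the triangle (of sides `x + y`, `y + z`, `x + z`) which connects the centers. -/
noncomputable def discAngle (x y z : ℝ) : ℝ :=
  Real.arccos (((x + y) ^ 2 + (y + z) ^ 2 - (x + z) ^ 2) / (2 * (x + y) * (y + z)))

/-- The sum of the angles between circularly consecutive discs of the word `w`, seen from the
center of a small disc tangent to them. -/
noncomputable def smallAngleSum (r s : ℝ) (w : List Size) : ℝ :=
  (List.zipWith (fun a b : Size => discAngle (a.radius r s) s (b.radius r s)) w (w.rotate 1)).sum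

/-- The radii `r`, `s` satisfy the equation of the small corona `w`: the angles add up to `2π`. -/
def SatisfiesSmallCorona (r s : ℝ) (w : List Size) : Prop :=
  smallAngleSum r s w = 2 * Real.pi

/-- The word `1srrs`. -/
def w1srrs : List Size := [.large, .small, .medium, .medium, .small]

/-- The word `1s1ss`. -/
def w1s1ss : List Size := [.large, .small, .large, .small, .small]

/-- The set `X` is a triangular grid: the lattice of vertices of a tiling of the plane by
equilateral triangles. -/
def IsTriangularGrid (X : Set ℂ) : Prop :=
  ∃ c u v : ℂ, u ≠ 0 ∧ ‖u‖ = ‖v‖ ∧ ‖u - v‖ = ‖u‖ ∧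
    X = {x | ∃ m n : ℤ, x = c + m * u + n * v}

end DiscPacking

/-! In a compact packing two tangent discs have a common neighbor on each side of the edge joining
their centers (`IsCompactPacking.exists_tangent_tangent`). Hence around a small disc every neighbor
is followed, in either sense, by a tangent one, at an angle taken from the finite list `ang`. A
partly known corona can then be completed by exclusion: a word is impossible if it leaves a positive
gap narrower than the angle required by the two discs that face it.

The equation of 1s1ss says that the angle 1ss is 5π/12, so s/(1+s) = cos(5π/12); the equation of
1srrs then fixes r by monotonicity. The estimates of `ang_bounds` make the completion unique in two
situations (`nbr_of_large_large`, `nbr_of_large_small`). Consequently two of the small neighbors of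
a 1s1ss disc are 1s1ss discs again (`isGood_five`, `isGood_fifteen`). Composing these two moves
rotates the pattern by π/3 about a large disc or carries it to the next large disc. This produces a
triangular lattice of large discs, each with twelve small neighbors. Every point of the plane is so
close to the lattice that any further disc would overlap one of these small discs
(`eq_latticePoint_or`), which gives (3).

For (2), consecutive neighbors of a smallest disc all turn in the same sense, so the corona angles
add up to a multiple of 2π (`exists_sum_discAngle_eq`), and size estimates leave only 2π. Both
equations therefore hold, (3) applies, and it contradicts the medium discs of 1srrs. -/

namespace DiscPacking

/-! ### Contact points of tangent discs. -/

theorem Disc.eq_of_center_radius {d e : Disc} (hc : d.center = e.center)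
    (hr : d.radius = e.radius) : d = e := by
  cases d; cases e; simp_all

theorem Disc.Tangent.symm {d e : Disc} (h : d.Tangent e) : e.Tangent d := by
  unfold Disc.Tangent at *
  rw [dist_comm, h, add_comm]

theorem IsPacking.radius_add_le_dist {P : Set Disc} (hP : IsPacking P) {d e : Disc} (hd : d ∈ P)
    (he : e ∈ P) (hne : d ≠ e) : d.radius + e.radius ≤ dist d.center e.center :=
  (disjoint_ball_ball_iff d.radius_pos e.radius_pos).1 (hP hd he hne)

/-- The point that divides the segment between the centers of `d` and `e` in the ratio of the
radii. -/
noncomputable def contactPoint (d e : Disc) : ℂ :=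
  (e.radius * d.center + d.radius * e.center) / (d.radius + e.radius)

theorem contactPoint_comm (d e : Disc) : contactPoint d e = contactPoint e d := by
  unfold contactPoint; ring

/-- Stewart's theorem for the point that divides a segment in the ratio x : y. -/
theorem add_mul_sq_norm_sub_div (p a b : ℂ) (x y : ℝ) (h : x + y ≠ 0) :
    (x + y) * ‖p - (y * a + x * b) / (x + y)‖ ^ 2 =
      y * ‖p - a‖ ^ 2 + x * ‖p - b‖ ^ 2 - x * y / (x + y) * ‖a - b‖ ^ 2 := by
  have e : (y * a + x * b) / ((x : ℂ) + y) =
      ⟨(y * a.re + x * b.re) / (x + y), (y * a.im + x * b.im) / (x + y)⟩ := by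
    rw [← Complex.ofReal_add]
    apply Complex.ext
    · rw [Complex.div_ofReal_re]; simp
    · rw [Complex.div_ofReal_im]; simp
  rw [e]
  simp only [Complex.sq_norm, Complex.normSq_apply, Complex.sub_re, Complex.sub_im]
  field_simp
  ring

theorem contactPoint_mem_segment (d e : Disc) :
    contactPoint d e ∈ segment ℝ d.center e.center := by
  have hd := d.radius_pos
  have he := e.radius_pos
  have h : ((d.radius : ℂ) + e.radius) ≠ 0 := by
    rw [← Complex.ofReal_add]; exact_mod_cast (add_pos hd he).ne'
  refine ⟨e.radius / (d.radius + e.radius), d.radius / (d.radius + e.radius), by positivity,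
    by positivity, by field_simp; ring, ?_⟩
  unfold contactPoint
  simp only [Complex.real_smul]
  push_cast
  field_simp

theorem dist_contactPoint_left {d e : Disc} (h : d.Tangent e) :
    dist (contactPoint d e) d.center = d.radius := by
  have hd := d.radius_pos
  have he := e.radius_pos
  have h0 : ((d.radius : ℂ) + e.radius) ≠ 0 := by
    rw [← Complex.ofReal_add]; exact_mod_cast (add_pos hd he).ne'
  have : contactPoint d e - d.center =
      ((d.radius / (d.radius + e.radius) : ℝ) : ℂ) * (e.center - d.center) := by
    unfold contactPoint; push_cast; field_simp; ring
  have h' := h.symm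
  unfold Disc.Tangent at h'
  rw [Complex.dist_eq] at h'
  rw [Complex.dist_eq, this, norm_mul, h', Complex.norm_real, Real.norm_of_nonneg (by positivity)]
  field_simp
  ring

/-- A third disc of a packing stays away from the contact point of two tangent discs. -/
theorem sq_radius_add_le_sq_dist_contactPoint {P : Set Disc} (hP : IsPacking P) {d e f : Disc}
    (hd : d ∈ P) (he : e ∈ P) (hf : f ∈ P) (h : d.Tangent e) (hfd : f ≠ d) (hfe : f ≠ e) :
    f.radius ^ 2 + 4 * f.radius * (d.radius * e.radius / (d.radius + e.radius)) ≤
      ‖f.center - contactPoint d e‖ ^ 2 := by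
  have h1 := hP.radius_add_le_dist hf hd hfd
  have h2 := hP.radius_add_le_dist hf he hfe
  have hd0 := d.radius_pos
  have he0 := e.radius_pos
  have hf0 := f.radius_pos
  have h3 := add_mul_sq_norm_sub_div f.center d.center e.center d.radius e.radius (by positivity)
  rw [← contactPoint] at h3
  unfold Disc.Tangent at h
  rw [Complex.dist_eq] at h h1 h2
  rw [h] at h3
  have h4 := mul_le_mul_of_nonneg_left (pow_le_pow_left₀ (by positivity) h1 2) he0.le
  have h5 := mul_le_mul_of_nonneg_left (pow_le_pow_left₀ (by positivity) h2 2) hd0.le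
  have h6 : 0 < d.radius + e.radius := by positivity
  refine le_of_mul_le_mul_left ?_ h6
  rw [h3]
  have e1 : d.radius * e.radius / (d.radius + e.radius) * (d.radius + e.radius) ^ 2 =
      d.radius * e.radius * (d.radius + e.radius) := by field_simp
  have e2 : (d.radius + e.radius) * (f.radius ^ 2 +
      4 * f.radius * (d.radius * e.radius / (d.radius + e.radius))) =
      (d.radius + e.radius) * f.radius ^ 2 + 4 * f.radius * (d.radius * e.radius) := by
    field_simp
  rw [e1, e2]
  nlinarith

theorem eq_or_eq_of_dist_contactPoint_le {P : Set Disc} (hP : IsPacking P) {d e f : Disc}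
    (hd : d ∈ P) (he : e ∈ P) (hf : f ∈ P) (h : d.Tangent e)
    (hT : dist (contactPoint d e) f.center ≤ f.radius) : f = d ∨ f = e := by
  by_contra! hne
  have h1 := sq_radius_add_le_sq_dist_contactPoint hP hd he hf h hne.1 hne.2
  rw [dist_comm, Complex.dist_eq] at hT
  have h2 := pow_le_pow_left₀ (norm_nonneg _) hT 2
  have hd0 := d.radius_pos
  have he0 := e.radius_pos
  have hf0 := f.radius_pos
  have : 0 < 4 * f.radius * (d.radius * e.radius / (d.radius + e.radius)) := by positivity
  linarith

theorem sq_norm_real_mul_add_I (x y : ℝ) (v : ℂ) :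
    ‖(x : ℂ) * v + y * (Complex.I * v)‖ ^ 2 = (x ^ 2 + y ^ 2) * ‖v‖ ^ 2 := by
  simp only [Complex.sq_norm, Complex.normSq_apply, Complex.add_re, Complex.mul_re, Complex.add_im,
    Complex.mul_im, Complex.ofReal_re, Complex.ofReal_im, Complex.I_re, Complex.I_im]
  ring

/-- Short of some height, the points of the common tangent at the contact point of two tangent
discs lie in no disc of the packing. -/
theorem exists_forall_radius_lt_dist {P : Set Disc} (hP : IsPacking P) {s : ℝ} (hs : 0 < s)
    (hsP : ∀ d ∈ P, s ≤ d.radius) {d e : Disc} (hd : d ∈ P) (he : e ∈ P) (h : d.Tangent e) :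
    ∃ τ₀ > 0, ∀ τ : ℝ, 0 < τ → τ ≤ τ₀ → ∀ f ∈ P, f.radius <
      dist (contactPoint d e + τ * (Complex.I * (e.center - d.center))) f.center := by
  have hd0 := d.radius_pos
  have he0 := e.radius_pos
  have h0 : ((d.radius : ℂ) + e.radius) ≠ 0 := by
    rw [← Complex.ofReal_add]; exact_mod_cast (add_pos hd0 he0).ne'
  set R := d.radius + e.radius with hR
  have hR0 : 0 < R := by positivity
  set k := d.radius * e.radius / R with hk
  have hk0 : 0 < k := by positivity
  have hv : ‖e.center - d.center‖ = R := by
    have := h.symm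
    unfold Disc.Tangent at this
    rw [Complex.dist_eq] at this
    rw [this, hR, add_comm]
  -- The point has height ε = τR on the common tangent. Third discs, of radius ρ, are avoided
  -- because (ρ + ε)² < ρ² + 4ρk when ε ≤ k and ε ≤ s ≤ ρ.
  refine ⟨min k s / R, by positivity, fun τ hτ hτ' f hf => ?_⟩
  have hε : τ * R ≤ min k s := (le_div_iff₀ hR0).1 hτ'
  have hτR : 0 < τ * R := by positivity
  have hf0 := f.radius_pos
  by_cases hfd : f = d
  · subst hfd
    rw [Complex.dist_eq]
    have : contactPoint f e + τ * (Complex.I * (e.center - f.center)) - f.center =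
        ((f.radius / R : ℝ) : ℂ) * (e.center - f.center) +
          τ * (Complex.I * (e.center - f.center)) := by
      unfold contactPoint; rw [hR]; push_cast; field_simp; ring
    refine lt_of_pow_lt_pow_left₀ 2 (norm_nonneg _) ?_
    rw [this, sq_norm_real_mul_add_I, hv, add_mul, ← mul_pow, ← mul_pow, div_mul_cancel₀ _ hR0.ne']
    nlinarith
  by_cases hfe : f = e
  · subst hfe
    rw [Complex.dist_eq]
    have : contactPoint d f + τ * (Complex.I * (f.center - d.center)) - f.center =
        ((-(f.radius / R) : ℝ) : ℂ) * (f.center - d.center) +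
          τ * (Complex.I * (f.center - d.center)) := by
      unfold contactPoint; rw [hR]; push_cast; field_simp; ring
    refine lt_of_pow_lt_pow_left₀ 2 (norm_nonneg _) ?_
    rw [this, sq_norm_real_mul_add_I, hv, add_mul, ← mul_pow, ← mul_pow, neg_mul,
      div_mul_cancel₀ _ hR0.ne']
    nlinarith
  have h1 := sq_radius_add_le_sq_dist_contactPoint hP hd he hf h hfd hfe
  have h2 : ‖f.center - contactPoint d e‖ ≤
      ‖f.center - (contactPoint d e + τ * (Complex.I * (e.center - d.center)))‖ + τ * R := by
    have : f.center - contactPoint d e =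
      (f.center - (contactPoint d e + τ * (Complex.I * (e.center - d.center)))) +
        τ * (Complex.I * (e.center - d.center)) := by ring
    rw [this]
    refine (norm_add_le _ _).trans ?_
    rw [norm_mul, norm_mul, Complex.norm_I, hv, Complex.norm_real, Real.norm_of_nonneg hτ.le,
      one_mul]
  rw [dist_comm, Complex.dist_eq]
  by_contra! hcon
  have h3 : ‖f.center - contactPoint d e‖ ≤ f.radius + τ * R := by linarith
  have h4 := pow_le_pow_left₀ (norm_nonneg _) h3 2
  have h5 : τ * R ≤ k := hε.trans (min_le_left _ _)
  have h6 : τ * R ≤ f.radius := (hε.trans (min_le_right _ _)).trans (hsP f hf)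
  nlinarith

theorem segment_subset_union_closedBall {d e : Disc} (h : d.Tangent e) {y : ℂ}
    (hy : y ∈ segment ℝ d.center e.center) :
    dist y d.center ≤ d.radius ∨ dist y e.center ≤ e.radius := by
  have h1 := dist_add_dist_of_mem_segment hy
  unfold Disc.Tangent at h
  rw [dist_comm d.center y] at h1
  by_contra! hcon
  linarith

/-! ### Interior and boundary of a triangle. -/

/-- The point x only serves to show that the triangle is nondegenerate. -/
theorem combo_mem_interior_of_pos {a b c x y : ℂ}
    (hx : x ∈ interior (convexHull ℝ {a, b, c})) {α β γ : ℝ} (hα : 0 < α) (hβ : 0 < β)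
    (hγ : 0 < γ) (hsum : α + β + γ = 1) (hy : y = α • a + β • b + γ • c) :
    y ∈ interior (convexHull ℝ {a, b, c}) := by
  have hxK := interior_subset hx
  rw [convexHull_insert (by simp), mem_convexJoin] at hxK
  obtain ⟨a', ha', w, hw, hxw⟩ := hxK
  rw [convexHull_pair] at hw
  rw [Set.mem_singleton_iff] at ha'
  subst ha'
  obtain ⟨p, q, hp, hq, hpq, rfl⟩ := hw
  obtain ⟨p', q', hp', hq', hpq', rfl⟩ := hxw
  obtain ⟨δ, hδ, h1, h2, h3⟩ : ∃ δ > 0, δ * p' ≤ α ∧ δ * (q' * p) ≤ β ∧ δ * (q' * q) ≤ γ := by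
    refine ⟨min α (min β γ), by positivity, ?_, ?_, ?_⟩
    · exact (mul_le_of_le_one_right (by positivity) (by linarith)).trans (min_le_left _ _)
    · exact (mul_le_of_le_one_right (by positivity) (by nlinarith)).trans
        ((min_le_right _ _).trans (min_le_left _ _))
    · exact (mul_le_of_le_one_right (by positivity) (by nlinarith)).trans
        ((min_le_right _ _).trans (min_le_right _ _))
  have hconv : Convex ℝ (convexHull ℝ {a', b, c}) := convex_convexHull ℝ _
  have hA : a' ∈ convexHull ℝ {a', b, c} := subset_convexHull ℝ _ (by simp)
  have hB : b ∈ convexHull ℝ {a', b, c} := subset_convexHull ℝ _ (by simp)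
  have hC : c ∈ convexHull ℝ {a', b, c} := subset_convexHull ℝ _ (by simp)
  set x := p' • a' + q' • (p • b + q • c) with hxdef
  -- This is y + δ(y − x); δ is small enough to keep its weights nonnegative. So y lies strictly
  -- between the interior point x and a point of the triangle.
  have hk : (α + δ * (α - p')) • a' + ((β + δ * (β - q' * p)) • b +
      (γ + δ * (γ - q' * q)) • c) ∈ convexHull ℝ {a', b, c} := by
    have := hconv.sum_mem (t := Finset.univ)
      (w := ![α + δ * (α - p'), β + δ * (β - q' * p), γ + δ * (γ - q' * q)])
      (z := ![a', b, c]) ?_ ?_ ?_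
    · simpa [Fin.sum_univ_three, add_assoc] using this
    · intro i _
      fin_cases i
      · show 0 ≤ α + δ * (α - p'); nlinarith
      · show 0 ≤ β + δ * (β - q' * p); nlinarith
      · show 0 ≤ γ + δ * (γ - q' * q); nlinarith
    · simp only [Fin.sum_univ_three, Matrix.cons_val_zero, Matrix.cons_val_one, Matrix.cons_val]
      have : q' * p + q' * q = q' := by rw [← mul_add, hpq, mul_one]
      linear_combination (1 + δ) * hsum - δ * hpq' - δ * this
    · intro i _
      fin_cases i
      exacts [hA, hB, hC]
  refine hconv.openSegment_interior_self_subset_interior hx hk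
    ⟨δ / (1 + δ), 1 / (1 + δ), by positivity, by positivity, by field_simp; ring, ?_⟩
  rw [hy, hxdef]
  have h1δ : (1 + (δ : ℂ)) ≠ 0 := by exact_mod_cast (by positivity : (1 + δ) ≠ 0)
  simp only [Complex.real_smul]
  push_cast
  field_simp
  ring

theorem mem_segment_of_mem_convexHull_of_not_mem_interior {a b c x y : ℂ}
    (hx : x ∈ interior (convexHull ℝ {a, b, c})) (hy : y ∈ convexHull ℝ {a, b, c})
    (hy' : y ∉ interior (convexHull ℝ {a, b, c})) :
    y ∈ segment ℝ a b ∨ y ∈ segment ℝ b c ∨ y ∈ segment ℝ c a := by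
  have hyK := hy
  rw [convexHull_insert (by simp), mem_convexJoin] at hyK
  obtain ⟨a', ha', w, hw, hyw⟩ := hyK
  rw [convexHull_pair] at hw
  rw [Set.mem_singleton_iff] at ha'
  subst ha'
  obtain ⟨p, q, hp, hq, hpq, rfl⟩ := hw
  obtain ⟨p', q', hp', hq', hpq', rfl⟩ := hyw
  rcases hp'.eq_or_lt with rfl | hp'
  · obtain rfl : q' = 1 := by linarith
    exact .inr (.inl ⟨p, q, hp, hq, hpq, by simp⟩)
  rcases hq'.eq_or_lt with rfl | hq'
  · obtain rfl : p' = 1 := by linarith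
    exact .inl ⟨1, 0, by simp, by simp, by simp, by simp⟩
  rcases hp.eq_or_lt with rfl | hp
  · obtain rfl : q = 1 := by linarith
    exact .inr (.inr ⟨q', p', hq'.le, hp'.le, by linarith, by simp [add_comm]⟩)
  rcases hq.eq_or_lt with rfl | hq
  · obtain rfl : p = 1 := by linarith
    exact .inl ⟨p', q', hp'.le, hq'.le, by linarith, by simp⟩
  refine absurd (combo_mem_interior_of_pos hx hp' (mul_pos hq' hp) (mul_pos hq' hq) ?_ ?_) hy'
  · rw [add_assoc, ← mul_add, hpq, mul_one, hpq']
  · simp only [smul_add, smul_smul, add_assoc]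

theorem _root_.IsPreconnected.inter_frontier_nonempty {α : Type*} [TopologicalSpace α]
    {s t : Set α} (hs : IsPreconnected s) (h : (s ∩ t).Nonempty) (h' : (s ∩ tᶜ).Nonempty) :
    (s ∩ frontier t).Nonempty := by
  by_contra hcon
  have hcon' : ∀ x ∈ s, x ∉ frontier t := fun x hx hxt => hcon ⟨x, hx, hxt⟩
  obtain ⟨z, -, hz1, hz2⟩ := hs (interior t) (closure t)ᶜ isOpen_interior
    isClosed_closure.isOpen_compl
    (fun x hx => by
      by_contra hx'
      simp only [Set.mem_union, Set.mem_compl_iff, not_or, not_not] at hx'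
      exact hcon' x hx ⟨hx'.2, hx'.1⟩)
    (h.imp fun x hx => ⟨hx.1, by
      by_contra hx'
      exact hcon' x hx.1 ⟨subset_closure hx.2, hx'⟩⟩)
    (h'.imp fun x hx => ⟨hx.1, fun hx' => hcon' x hx.1 ⟨hx', fun hi => hx.2 (interior_subset hi)⟩⟩)
  exact hz2 (subset_closure (interior_subset hz1))

/-! ### Common neighbors of tangent discs. -/

/-- The contact point lies in no closed disc but d and e. A point of the edge ab lies in the disc a
or b, and once it is on the circle of one, it is on the circle of the other. -/
theorem eq_and_eq_of_contactPoint_mem_segment {P : Set Disc} (hP : IsPacking P) {d e a b : Disc}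
    (hd : d ∈ P) (he : e ∈ P) (ha : a ∈ P) (hb : b ∈ P) (h : d.Tangent e) (hab : a.Tangent b)
    (hT : contactPoint d e ∈ segment ℝ a.center b.center) :
    (a = d ∧ b = e) ∨ (a = e ∧ b = d) := by
  have h1 := dist_add_dist_of_mem_segment hT
  have hab' := hab
  unfold Disc.Tangent at hab'
  rw [dist_comm a.center (contactPoint d e)] at h1
  have hdT := dist_contactPoint_left h
  have heT := dist_contactPoint_left h.symm
  rw [contactPoint_comm] at heT
  have hne : a ≠ b := by
    rintro rfl
    have := a.radius_pos
    rw [dist_self] at hab'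
    linarith
  have key : ∀ f, f = d ∨ f = e → dist (contactPoint d e) f.center = f.radius := by
    rintro f (rfl | rfl) <;> assumption
  have hboth : (a = d ∨ a = e) ∧ (b = d ∨ b = e) := by
    rcases segment_subset_union_closedBall hab hT with h2 | h2
    · have h3 := eq_or_eq_of_dist_contactPoint_le hP hd he ha h h2
      have h4 := key a h3
      exact ⟨h3, eq_or_eq_of_dist_contactPoint_le hP hd he hb h (by linarith)⟩
    · have h3 := eq_or_eq_of_dist_contactPoint_le hP hd he hb h h2
      have h4 := key b h3
      exact ⟨eq_or_eq_of_dist_contactPoint_le hP hd he ha h (by linarith), h3⟩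
  rcases hboth with ⟨rfl | rfl, rfl | rfl⟩ <;> simp_all

/-- Two tangent discs of a compact packing have a common neighbor on the left of the segment which
connects their centers. -/
theorem IsCompactPacking.exists_tangent_tangent {P : Set Disc} (hP : IsCompactPacking P) {s : ℝ}
    (hs : 0 < s) (hsP : ∀ d ∈ P, s ≤ d.radius) {d e : Disc} (hd : d ∈ P) (he : e ∈ P)
    (h : d.Tangent e) : ∃ f ∈ P, d.Tangent f ∧ e.Tangent f ∧
      0 < ((starRingEnd ℂ) (e.center - d.center) * (f.center - d.center)).im := by
  obtain ⟨τ₀, hτ₀, hfree⟩ := exists_forall_radius_lt_dist hP.1 hs hsP hd he h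
  set v := e.center - d.center with hv
  set T := contactPoint d e with hT
  set x := T + τ₀ * (Complex.I * v) with hx
  have hv0 : v ≠ 0 := by
    intro h0
    have h1 : dist d.center e.center = 0 := by
      rw [dist_comm, Complex.dist_eq, ← hv, h0, norm_zero]
    have h2 := d.radius_pos
    have h3 := e.radius_pos
    unfold Disc.Tangent at h
    linarith
  have hxG : x ∉ contactGraph P := by
    rintro (⟨f, hf, hxf⟩ | ⟨f, hf, g, hg, hfg, hxfg⟩)
    · have := hfree τ₀ hτ₀ le_rfl f hf
      rw [← hx, hxf, dist_self] at this
      exact absurd f.radius_pos this.not_gt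
    · rcases segment_subset_union_closedBall hfg hxfg with h1 | h1
      · exact (hfree τ₀ hτ₀ le_rfl f hf).not_ge h1
      · exact (hfree τ₀ hτ₀ le_rfl g hg).not_ge h1
  obtain ⟨F, ⟨a, ha, b, hb, c, hc, hab, hbc, hca, rfl, hdisj⟩, hxF⟩ := hP.2 x hxG
  have hTG : T ∈ contactGraph P := .inr ⟨d, hd, e, he, h, contactPoint_mem_segment d e⟩
  have hTF : T ∉ interior (convexHull ℝ {a.center, b.center, c.center}) :=
    fun hmem => Set.disjoint_left.1 hdisj hmem hTG
  have hclosed : IsClosed (convexHull ℝ {a.center, b.center, c.center}) :=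
    (Set.toFinite _).isClosed_convexHull ℝ
  -- The segment from x, in the face, to T, on the graph, must cross the boundary of the face.
  obtain ⟨y, hyseg, hyfr⟩ := (convex_segment (𝕜 := ℝ) x T).isPreconnected.inter_frontier_nonempty
    ⟨x, left_mem_segment ℝ x T, hxF⟩ ⟨T, right_mem_segment ℝ x T, hTF⟩
  rw [frontier, interior_interior] at hyfr
  have hyK : y ∈ convexHull ℝ {a.center, b.center, c.center} :=
    closure_minimal interior_subset hclosed hyfr.1
  have hyedge := mem_segment_of_mem_convexHull_of_not_mem_interior hxF hyK hyfr.2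
  have hyball : ∃ f ∈ P, dist y f.center ≤ f.radius := by
    rcases hyedge with h1 | h1 | h1
    · rcases segment_subset_union_closedBall hab h1 with h2 | h2
      exacts [⟨a, ha, h2⟩, ⟨b, hb, h2⟩]
    · rcases segment_subset_union_closedBall hbc h1 with h2 | h2
      exacts [⟨b, hb, h2⟩, ⟨c, hc, h2⟩]
    · rcases segment_subset_union_closedBall hca h1 with h2 | h2
      exacts [⟨c, hc, h2⟩, ⟨a, ha, h2⟩]
  -- Before T the segment meets no disc, whereas y lies on an edge and hence in a disc.
  obtain rfl : y = T := by
    obtain ⟨f, hf, hyf⟩ := hyball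
    obtain ⟨p, q, hp, hq, hpq, rfl⟩ := hyseg
    rcases hp.eq_or_lt with rfl | hp
    · obtain rfl : q = 1 := by linarith
      simp
    · refine absurd hyf (not_le.2 ?_)
      have hpq' : (p : ℂ) + q = 1 := by exact_mod_cast hpq
      have e1 : p • x + q • T = T + ((p * τ₀ : ℝ) : ℂ) * (Complex.I * v) := by
        rw [hx, Complex.real_smul, Complex.real_smul]
        push_cast
        linear_combination T * hpq'
      rw [e1]
      exact hfree (p * τ₀) (by positivity) (by nlinarith) f hf
  -- The point x is to the left of the line through the centers of d and e, and it is a convex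
  -- combination of the three centers; only f can contribute to that side.
  have finish : ∀ f ∈ P, d.Tangent f → e.Tangent f →
      x ∈ convexHull ℝ {d.center, e.center, f.center} →
      ∃ f ∈ P, d.Tangent f ∧ e.Tangent f ∧
        0 < ((starRingEnd ℂ) v * (f.center - d.center)).im := by
    intro f hf hdf hef hxf
    refine ⟨f, hf, hdf, hef, ?_⟩
    rw [convexHull_insert (by simp), mem_convexJoin] at hxf
    obtain ⟨a', ha', w, hw, hxw⟩ := hxf
    rw [convexHull_pair] at hw
    rw [Set.mem_singleton_iff] at ha'
    subst ha'
    obtain ⟨p, q, hp, hq, hpq, rfl⟩ := hw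
    obtain ⟨p', q', hp', hq', hpq', hxw⟩ := hxw
    have h1 : ((starRingEnd ℂ) v * (x - d.center)).im =
        q' * q * ((starRingEnd ℂ) v * (f.center - d.center)).im := by
      have hpq1 : (p : ℂ) + q = 1 := by exact_mod_cast hpq
      have hpq2 : (p' : ℂ) + q' = 1 := by exact_mod_cast hpq'
      have : x - d.center = ((q' * p : ℝ) : ℂ) * v +
          ((q' * q : ℝ) : ℂ) * (f.center - d.center) := by
        rw [← hxw, hv]
        simp only [Complex.real_smul]
        push_cast
        linear_combination d.center * hpq2 + d.center * q' * hpq1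
      rw [this]
      simp only [Complex.mul_im, Complex.mul_re, Complex.add_im, Complex.add_re, Complex.conj_re,
        Complex.conj_im, Complex.ofReal_re, Complex.ofReal_im]
      ring
    have h2 : 0 < ((starRingEnd ℂ) v * (x - d.center)).im := by
      have h0 : ((d.radius : ℂ) + e.radius) ≠ 0 := by
        rw [← Complex.ofReal_add]
        exact_mod_cast (add_pos d.radius_pos e.radius_pos).ne'
      have : x - d.center = ((d.radius / (d.radius + e.radius) : ℝ) : ℂ) * v +
          τ₀ * (Complex.I * v) := by
        rw [hx, hT, hv]
        unfold contactPoint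
        push_cast
        field_simp
        ring
      have h3 : ((starRingEnd ℂ) v * (x - d.center)).im = τ₀ * Complex.normSq v := by
        rw [this]
        simp only [Complex.mul_im, Complex.mul_re, Complex.add_im, Complex.add_re,
          Complex.conj_re, Complex.conj_im, Complex.ofReal_re, Complex.ofReal_im, Complex.I_re,
          Complex.I_im, Complex.normSq_apply]
        ring
      rw [h3]
      exact mul_pos hτ₀ (Complex.normSq_pos.2 hv0)
    rw [h1] at h2
    exact pos_of_mul_pos_right h2 (by positivity)
  have hxK : ∀ A : Set ℂ, A = {a.center, b.center, c.center} → x ∈ convexHull ℝ A := by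
    rintro A rfl; exact interior_subset hxF
  rcases hyedge with h1 | h1 | h1
  · rcases eq_and_eq_of_contactPoint_mem_segment hP.1 hd he ha hb h hab h1 with
      ⟨rfl, rfl⟩ | ⟨rfl, rfl⟩
    · exact finish c hc hca.symm hbc (hxK _ rfl)
    · exact finish c hc hbc hca.symm (hxK _ (Set.insert_comm _ _ _))
  · rcases eq_and_eq_of_contactPoint_mem_segment hP.1 hd he hb hc h hbc h1 with
      ⟨rfl, rfl⟩ | ⟨rfl, rfl⟩
    · exact finish a ha hab.symm hca
        (hxK _ (by ext; simp only [Set.mem_insert_iff, Set.mem_singleton_iff]; tauto))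
    · exact finish a ha hca hab.symm
        (hxK _ (by ext; simp only [Set.mem_insert_iff, Set.mem_singleton_iff]; tauto))
  · rcases eq_and_eq_of_contactPoint_mem_segment hP.1 hd he hc ha h hca h1 with
      ⟨rfl, rfl⟩ | ⟨rfl, rfl⟩
    · exact finish b hb hbc.symm hab
        (hxK _ (by ext; simp only [Set.mem_insert_iff, Set.mem_singleton_iff]; tauto))
    · exact finish b hb hab hbc.symm
        (hxK _ (by ext; simp only [Set.mem_insert_iff, Set.mem_singleton_iff]; tauto))

/-! ### Angles between tangent neighbors. -/

/-- The product form makes the monotonicity in the two outer radii visible: the squared sine of half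
the angle is (x/(x+y))(z/(z+y)). -/
theorem discAngle_eq {x y z : ℝ} (hx : 0 < x) (hy : 0 < y) (hz : 0 < z) :
    discAngle x y z = Real.arccos (1 - 2 * (x / (x + y)) * (z / (z + y))) := by
  unfold discAngle
  congr 1
  field_simp
  ring

theorem discAngle_comm (x y z : ℝ) : discAngle x y z = discAngle z y x := by
  unfold discAngle
  congr 1
  ring

theorem div_add_mem_Ioo {x y : ℝ} (hx : 0 < x) (hy : 0 < y) : x / (x + y) ∈ Set.Ioo (0 : ℝ) 1 :=
  ⟨by positivity, (div_lt_one (by positivity)).2 (by linarith)⟩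

theorem cos_discAngle {x y z : ℝ} (hx : 0 < x) (hy : 0 < y) (hz : 0 < z) :
    Real.cos (discAngle x y z) = 1 - 2 * (x / (x + y)) * (z / (z + y)) := by
  have h1 := div_add_mem_Ioo hx hy
  have h2 := div_add_mem_Ioo hz hy
  rw [discAngle_eq hx hy hz, Real.cos_arccos]
  · nlinarith [h1.1, h1.2, h2.1, h2.2]
  · nlinarith [h1.1, h1.2, h2.1, h2.2, mul_pos h1.1 h2.1]

theorem discAngle_nonneg (x y z : ℝ) : 0 ≤ discAngle x y z := Real.arccos_nonneg _

theorem discAngle_le_pi (x y z : ℝ) : discAngle x y z ≤ Real.pi := Real.arccos_le_pi _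

theorem discAngle_lt_of_cos_lt {x y z θ : ℝ} (hx : 0 < x) (hy : 0 < y) (hz : 0 < z) (h0 : 0 ≤ θ)
    (h : Real.cos θ < 1 - 2 * (x / (x + y)) * (z / (z + y))) : discAngle x y z < θ := by
  rw [← cos_discAngle hx hy hz] at h
  by_contra! hcon
  exact h.not_ge (Real.cos_le_cos_of_nonneg_of_le_pi h0 (discAngle_le_pi _ _ _) hcon)

theorem lt_discAngle_of_lt_cos {x y z θ : ℝ} (hx : 0 < x) (hy : 0 < y) (hz : 0 < z)
    (h0 : θ ≤ Real.pi) (h : 1 - 2 * (x / (x + y)) * (z / (z + y)) < Real.cos θ) :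
    θ < discAngle x y z := by
  rw [← cos_discAngle hx hy hz] at h
  by_contra! hcon
  exact h.not_ge (Real.cos_le_cos_of_nonneg_of_le_pi (discAngle_nonneg _ _ _) h0 hcon)

theorem discAngle_lt_discAngle {x x' y z : ℝ} (hx : 0 < x) (hy : 0 < y) (hz : 0 < z)
    (h : x < x') : discAngle x y z < discAngle x' y z := by
  refine discAngle_lt_of_cos_lt hx hy hz (discAngle_nonneg _ _ _) ?_
  rw [cos_discAngle (hx.trans h) hy hz]
  have h1 : x / (x + y) < x' / (x' + y) := by
    rw [div_lt_div_iff₀ (by positivity) (by linarith)]; nlinarith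
  have h2 : 0 < z / (z + y) := by positivity
  nlinarith

theorem discAngle_le_discAngle {x x' y z : ℝ} (hx : 0 < x) (hy : 0 < y) (hz : 0 < z)
    (h : x ≤ x') : discAngle x y z ≤ discAngle x' y z := by
  rcases h.eq_or_lt with rfl | h
  exacts [le_rfl, (discAngle_lt_discAngle hx hy hz h).le]

theorem discAngle_self_right {x y : ℝ} (hx : 0 < x) (hy : 0 < y) :
    discAngle x y y = Real.arccos (y / (x + y)) := by
  rw [discAngle_eq hx hy hy]
  congr 1
  field_simp
  ring

theorem discAngle_self {y : ℝ} (hy : 0 < y) : discAngle y y y = Real.pi / 3 := by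
  rw [discAngle_self_right hy hy]
  refine Real.arccos_eq_of_eq_cos (by positivity) (by linarith [Real.pi_pos]) ?_
  rw [Real.cos_pi_div_three]
  field_simp
  norm_num

/-- No disc fits between two tangent neighbors of a smallest disc. -/
theorem discAngle_lt_add {a b c y : ℝ} (hy : 0 < y) (ha : y ≤ a) (hb : y ≤ b) (hc : y ≤ c) :
    discAngle a y b < discAngle a y c + discAngle c y b := by
  have ha0 := hy.trans_le ha
  have hb0 := hy.trans_le hb
  -- By monotonicity the worst case is c = y.
  have h1 : discAngle a y y ≤ discAngle a y c := by
    rw [discAngle_comm a, discAngle_comm a]; exact discAngle_le_discAngle hy hy ha0 hc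
  have h2 : discAngle b y y ≤ discAngle c y b := by
    rw [discAngle_comm b]; exact discAngle_le_discAngle hy hy hb0 hc
  refine lt_of_lt_of_le ?_ (add_le_add h1 h2)
  refine discAngle_lt_of_cos_lt ha0 hy hb0
    (add_nonneg (discAngle_nonneg _ _ _) (discAngle_nonneg _ _ _)) ?_
  rw [discAngle_self_right ha0 hy, discAngle_self_right hb0 hy]
  have key : ∀ a, y ≤ a →
      0 < y / (a + y) ∧ y / (a + y) ≤ 1 / 2 ∧ a / (a + y) = 1 - y / (a + y) := by
    intro a ha
    have : 0 < a := hy.trans_le ha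
    refine ⟨by positivity, ?_, by field_simp; ring⟩
    rw [div_le_div_iff₀ (by positivity) (by norm_num)]
    linarith
  obtain ⟨hu0, hu1, eu⟩ := key a ha
  obtain ⟨hv0, hv1, ev⟩ := key b hb
  rw [eu, ev, Real.cos_add, Real.cos_arccos (by linarith) (by linarith),
    Real.cos_arccos (by linarith) (by linarith), Real.sin_arccos, Real.sin_arccos]
  generalize y / (a + y) = u at *
  generalize y / (b + y) = v at *
  -- This crude bound suffices: what then remains is u(1−v) + v(1−u) ≥ 0.
  have h3 : 1 - u < √(1 - u ^ 2) := Real.lt_sqrt_of_sq_lt (by nlinarith)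
  have h4 : 1 - v < √(1 - v ^ 2) := Real.lt_sqrt_of_sq_lt (by nlinarith)
  have h5 : (1 - u) * (1 - v) < √(1 - u ^ 2) * √(1 - v ^ 2) :=
    mul_lt_mul'' h3 h4 (by linarith) (by linarith)
  nlinarith

/-! ### Neighbors of a disc described by direction and radius. -/

/-- `P` contains the disc of center `z` and radius `ρ`. -/
def HasDisc (P : Set Disc) (z : ℂ) (ρ : ℝ) : Prop :=
  ∃ d ∈ P, d.center = z ∧ d.radius = ρ

theorem HasDisc.radius_pos {P : Set Disc} {z : ℂ} {ρ : ℝ} (h : HasDisc P z ρ) : 0 < ρ := by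
  obtain ⟨d, -, -, rfl⟩ := h
  exact d.radius_pos

theorem HasDisc.add_le_dist {P : Set Disc} (hP : IsPacking P) {z z' : ℂ} {ρ ρ' : ℝ}
    (h : HasDisc P z ρ) (h' : HasDisc P z' ρ') (hne : z ≠ z') : ρ + ρ' ≤ ‖z - z'‖ := by
  obtain ⟨d, hd, rfl, rfl⟩ := h
  obtain ⟨e, he, rfl, rfl⟩ := h'
  rw [← Complex.dist_eq]
  exact hP.radius_add_le_dist hd he (by rintro rfl; exact hne rfl)

theorem HasDisc.radius_eq {P : Set Disc} (hP : IsPacking P) {z : ℂ} {ρ ρ' : ℝ}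
    (h : HasDisc P z ρ) (h' : HasDisc P z ρ') : ρ = ρ' := by
  obtain ⟨d, hd, rfl, rfl⟩ := h
  obtain ⟨e, he, hde, rfl⟩ := h'
  by_contra hne
  have := hP.radius_add_le_dist hd he (by rintro rfl; exact hne rfl)
  rw [hde, dist_self] at this
  linarith [d.radius_pos, e.radius_pos]

theorem sq_norm_mul_sub_mul {w w' : ℂ} (hw : ‖w‖ = 1) (hw' : ‖w'‖ = 1) (a b : ℝ) :
    ‖(a : ℂ) * w - b * w'‖ ^ 2 = a ^ 2 + b ^ 2 - 2 * a * b * ((starRingEnd ℂ) w * w').re := by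
  have h1 : w.re * w.re + w.im * w.im = 1 := by
    rw [← Complex.normSq_apply, ← Complex.sq_norm, hw, one_pow]
  have h2 : w'.re * w'.re + w'.im * w'.im = 1 := by
    rw [← Complex.normSq_apply, ← Complex.sq_norm, hw', one_pow]
  simp only [Complex.sq_norm, Complex.normSq_apply, Complex.sub_re, Complex.mul_re,
    Complex.ofReal_re, Complex.ofReal_im, Complex.sub_im, Complex.mul_im, Complex.conj_re,
    Complex.conj_im]
  linear_combination a ^ 2 * h1 + b ^ 2 * h2

/-- Law of cosines in terms of `discAngle`. -/
theorem sq_add_eq_discAngle {x y z : ℝ} (hx : 0 < x) (hy : 0 < y) (hz : 0 < z) :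
    (x + z) ^ 2 = (y + x) ^ 2 + (y + z) ^ 2 -
      2 * (y + x) * (y + z) * Real.cos (discAngle x y z) := by
  rw [cos_discAngle hx hy hz]
  field_simp
  ring

theorem norm_eq_one_of_tangent {d e : Disc} (h : d.Tangent e) :
    ‖(e.center - d.center) / (d.radius + e.radius)‖ = 1 := by
  have h' := h.symm
  unfold Disc.Tangent at h'
  rw [Complex.dist_eq] at h'
  have hd := d.radius_pos
  have he := e.radius_pos
  rw [norm_div, h', ← Complex.ofReal_add, Complex.norm_real, Real.norm_of_nonneg (by positivity)]
  field_simp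
  ring

theorem Disc.radius_add_ne_zero (d e : Disc) : (d.radius : ℂ) + e.radius ≠ 0 := by
  rw [← Complex.ofReal_add]; exact_mod_cast (add_pos d.radius_pos e.radius_pos).ne'

theorem Disc.center_eq (d e : Disc) : e.center =
    d.center + (d.radius + e.radius) * ((e.center - d.center) / (d.radius + e.radius)) := by
  have := d.radius_add_ne_zero e
  field_simp
  ring

/-- In directions seen from a common neighbor, two tangent discs differ by `discAngle`. -/
theorem re_eq_cos_of_tangent {d e f : Disc} (hde : d.Tangent e) (hdf : d.Tangent f)
    (hef : e.Tangent f) :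
    ((starRingEnd ℂ) ((e.center - d.center) / (d.radius + e.radius)) *
      ((f.center - d.center) / (d.radius + f.radius))).re =
      Real.cos (discAngle e.radius d.radius f.radius) := by
  have h := sq_norm_mul_sub_mul (norm_eq_one_of_tangent hde) (norm_eq_one_of_tangent hdf)
    (d.radius + e.radius) (d.radius + f.radius)
  have h1 := d.radius_add_ne_zero e
  have h2 := d.radius_add_ne_zero f
  have hd := d.radius_pos
  have he := e.radius_pos
  have hf := f.radius_pos
  rw [Complex.ofReal_add, Complex.ofReal_add, mul_div_cancel₀ _ h1, mul_div_cancel₀ _ h2,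
    sub_sub_sub_cancel_right, ← Complex.dist_eq, hef, sq_add_eq_discAngle he hd hf] at h
  have h3 : 0 < 2 * (d.radius + e.radius) * (d.radius + f.radius) := by positivity
  exact (mul_left_cancel₀ h3.ne' (by linarith)).symm

theorem eq_exp_of_re_eq_cos {ζ : ℂ} (hζ : ‖ζ‖ = 1) {θ : ℝ} (h0 : 0 ≤ θ) (hπ : θ ≤ Real.pi)
    (h : ζ.re = Real.cos θ) : (0 ≤ ζ.im → ζ = Complex.exp ((1 * θ : ℝ) * Complex.I)) ∧
      (ζ.im ≤ 0 → ζ = Complex.exp ((-1 * θ : ℝ) * Complex.I)) := by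
  have h1 : ζ.re * ζ.re + ζ.im * ζ.im = 1 := by
    rw [← Complex.normSq_apply, ← Complex.sq_norm, hζ, one_pow]
  have h2 := Real.sin_nonneg_of_nonneg_of_le_pi h0 hπ
  have h3 := Real.sin_sq_add_cos_sq θ
  rw [h] at h1
  refine ⟨fun hi => ?_, fun hi => ?_⟩
  · apply Complex.ext
    · rw [Complex.exp_ofReal_mul_I_re, one_mul, h]
    · rw [Complex.exp_ofReal_mul_I_im, one_mul]
      nlinarith
  · apply Complex.ext
    · rw [Complex.exp_ofReal_mul_I_re, neg_one_mul, Real.cos_neg, h]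
    · rw [Complex.exp_ofReal_mul_I_im, neg_one_mul, Real.sin_neg]
      nlinarith

theorem eq_mul_of_conj_mul_eq {w w' ζ : ℂ} (hw : ‖w‖ = 1) (h : (starRingEnd ℂ) w * w' = ζ) :
    w' = w * ζ := by
  rw [← h, ← mul_assoc, Complex.mul_conj, Complex.normSq_eq_norm_sq, hw]
  simp

theorem eq_mul_exp_of_tangent {d e f : Disc} (hde : d.Tangent e) (hdf : d.Tangent f)
    (hef : e.Tangent f) :
    (0 ≤ ((starRingEnd ℂ) (e.center - d.center) * (f.center - d.center)).im →
      (f.center - d.center) / (d.radius + f.radius) =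
        (e.center - d.center) / (d.radius + e.radius) * Complex.exp
          ((1 * discAngle e.radius d.radius f.radius : ℝ) * Complex.I)) ∧
    (((starRingEnd ℂ) (e.center - d.center) * (f.center - d.center)).im ≤ 0 →
      (f.center - d.center) / (d.radius + f.radius) =
        (e.center - d.center) / (d.radius + e.radius) * Complex.exp
          ((-1 * discAngle e.radius d.radius f.radius : ℝ) * Complex.I)) := by
  have hre := re_eq_cos_of_tangent hde hdf hef
  have hw := norm_eq_one_of_tangent hde
  have hw' := norm_eq_one_of_tangent hdf
  have hd := d.radius_pos
  have he := e.radius_pos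
  have hf := f.radius_pos
  have him : ((starRingEnd ℂ) ((e.center - d.center) / (d.radius + e.radius)) *
      ((f.center - d.center) / (d.radius + f.radius))).im =
      ((starRingEnd ℂ) (e.center - d.center) * (f.center - d.center)).im /
        ((d.radius + e.radius) * (d.radius + f.radius)) := by
    rw [← Complex.div_ofReal_im]
    congr 1
    have h1 := d.radius_add_ne_zero e
    have h2 := d.radius_add_ne_zero f
    push_cast
    rw [map_div₀, map_add, Complex.conj_ofReal, Complex.conj_ofReal]
    field_simp
  have hpos : 0 < (d.radius + e.radius) * (d.radius + f.radius) := by positivity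
  have hζ : ‖(starRingEnd ℂ) ((e.center - d.center) / (d.radius + e.radius)) *
      ((f.center - d.center) / (d.radius + f.radius))‖ = 1 := by
    rw [norm_mul, RCLike.norm_conj, hw, hw', one_mul]
  have := eq_exp_of_re_eq_cos hζ (discAngle_nonneg _ _ _) (discAngle_le_pi _ _ _) hre
  rw [him] at this
  exact ⟨fun h => eq_mul_of_conj_mul_eq hw (this.1 (by positivity)),
    fun h => eq_mul_of_conj_mul_eq hw (this.2 (div_nonpos_of_nonpos_of_nonneg h hpos.le))⟩

/-- Around a disc of a compact packing, every neighbor has a next neighbor, in both senses of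
rotation. -/
theorem IsCompactPacking.exists_next {P : Set Disc} (hP : IsCompactPacking P) {s : ℝ}
    (hs : 0 < s) (hsP : ∀ d ∈ P, s ≤ d.radius) {z w : ℂ} {y x : ℝ} (hw : ‖w‖ = 1)
    (hz : HasDisc P z y) (hx : HasDisc P (z + (y + x) * w) x) {σ : ℝ} (hσ : σ = 1 ∨ σ = -1) :
    ∃ ρ, HasDisc P
      (z + (y + ρ) * (w * Complex.exp ((σ * discAngle x y ρ : ℝ) * Complex.I))) ρ := by
  obtain ⟨d, hd, rfl, rfl⟩ := hz
  obtain ⟨e, he, hec, rfl⟩ := hx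
  have hde : d.Tangent e := by
    unfold Disc.Tangent
    rw [dist_comm, Complex.dist_eq, hec, add_sub_cancel_left, norm_mul, hw, mul_one,
      ← Complex.ofReal_add, Complex.norm_real,
      Real.norm_of_nonneg (add_pos d.radius_pos e.radius_pos).le]
  have hwe : w = (e.center - d.center) / (d.radius + e.radius) := by
    have := d.radius_add_ne_zero e
    rw [hec]
    field_simp
    ring
  rcases hσ with rfl | rfl
  · obtain ⟨f, hf, hdf, hef, him⟩ := hP.exists_tangent_tangent hs hsP hd he hde
    refine ⟨f.radius, f, hf, ?_, rfl⟩
    rw [hwe, ← (eq_mul_exp_of_tangent hde hdf hef).1 him.le, ← Disc.center_eq]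
  -- The right side of the edge from d to e is the left side of the edge from e to d.
  · obtain ⟨f, hf, hef, hdf, him⟩ := hP.exists_tangent_tangent hs hsP he hd hde.symm
    refine ⟨f.radius, f, hf, ?_, rfl⟩
    have him' : ((starRingEnd ℂ) (e.center - d.center) * (f.center - d.center)).im ≤ 0 := by
      have : ((starRingEnd ℂ) (e.center - d.center) * (f.center - d.center)).im =
          -((starRingEnd ℂ) (d.center - e.center) * (f.center - e.center)).im := by
        simp only [Complex.mul_im, Complex.conj_re, Complex.conj_im, Complex.sub_re,
          Complex.sub_im]
        ring
      linarith
    rw [hwe, ← (eq_mul_exp_of_tangent hde hdf hef).2 him', ← Disc.center_eq]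

/-- The angle between two neighbors of a disc is at least that between tangent ones. -/
theorem re_le_cos_discAngle {P : Set Disc} (hP : IsPacking P) {z w w' : ℂ} {y x x' : ℝ}
    (hw : ‖w‖ = 1) (hw' : ‖w'‖ = 1) (hy : 0 < y) (hx : HasDisc P (z + (y + x) * w) x)
    (hx' : HasDisc P (z + (y + x') * w') x')
    (hne : z + (y + x) * w ≠ z + (y + x') * w') :
    ((starRingEnd ℂ) w * w').re ≤ Real.cos (discAngle x y x') := by
  have h := hx.add_le_dist hP hx' hne
  have h1 := hx.radius_pos
  have h2 := hx'.radius_pos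
  have h3 := pow_le_pow_left₀ (by positivity) h 2
  have h4 := sq_norm_mul_sub_mul hw hw' (y + x) (y + x')
  push_cast at h4
  rw [add_sub_add_left_eq_sub, h4, sq_add_eq_discAngle h1 hy h2] at h3
  have h5 : 0 < 2 * (y + x) * (y + x') := by positivity
  exact le_of_mul_le_mul_left (by linarith) h5

theorem norm_mul_exp {w : ℂ} (hw : ‖w‖ = 1) (θ : ℝ) : ‖w * Complex.exp (θ * Complex.I)‖ = 1 := by
  rw [norm_mul, hw, Complex.norm_exp_ofReal_mul_I, one_mul]

theorem conj_mul_mul_exp {w : ℂ} (hw : ‖w‖ = 1) (θ : ℝ) :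
    (starRingEnd ℂ) w * (w * Complex.exp (θ * Complex.I)) = Complex.exp (θ * Complex.I) := by
  rw [← mul_assoc, mul_comm _ w, Complex.mul_conj, Complex.normSq_eq_norm_sq, hw]
  simp

/-- Two neighbors of a disc cannot be too close in direction. -/
theorem not_hasDisc_of_angle {P : Set Disc} (hP : IsPacking P) {z w : ℂ} {y x x' : ℝ}
    (hw : ‖w‖ = 1) (hy : 0 < y) (hx : HasDisc P (z + (y + x) * w) x) {σ θ : ℝ}
    (hσ : σ = 1 ∨ σ = -1) (h1 : 2 * Real.pi - discAngle x y x' < θ) (h2 : θ < 2 * Real.pi) :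
    ¬ HasDisc P (z + (y + x') * (w * Complex.exp ((σ * θ : ℝ) * Complex.I))) x' := by
  intro hx'
  have hcos : Real.cos (σ * θ) = Real.cos (2 * Real.pi - θ) := by
    rw [Real.cos_two_pi_sub]
    rcases hσ with rfl | rfl <;> simp
  have hpi := discAngle_le_pi x y x'
  have hlt : Real.cos (discAngle x y x') < Real.cos (σ * θ) := by
    rw [hcos]
    exact Real.cos_lt_cos_of_nonneg_of_le_pi (by linarith) hpi (by linarith)
  have hre : ((starRingEnd ℂ) w * (w * Complex.exp ((σ * θ : ℝ) * Complex.I))).re =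
      Real.cos (σ * θ) := by
    rw [conj_mul_mul_exp hw, Complex.exp_ofReal_mul_I_re]
  -- Two descriptions of the same disc would need the same direction, which 0 < θ < 2π excludes.
  by_cases hne : z + (y + x) * w = z + (y + x') * (w * Complex.exp ((σ * θ : ℝ) * Complex.I))
  · have hr : x = x' := by
      rw [← hne] at hx'
      exact hx.radius_eq hP hx'
    subst hr
    have h0 := hx.radius_pos
    have hyx : (y : ℂ) + x ≠ 0 := by
      rw [← Complex.ofReal_add]; exact_mod_cast (by positivity : y + x ≠ 0)
    have hww := mul_left_cancel₀ hyx (add_left_cancel hne)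
    rw [← hww] at hre
    have : ((starRingEnd ℂ) w * w).re = 1 := by
      rw [mul_comm, Complex.mul_conj, Complex.normSq_eq_norm_sq, hw]; simp
    rw [this, hcos] at hre
    have h3 : Real.cos (2 * Real.pi - θ) < Real.cos 0 :=
      Real.cos_lt_cos_of_nonneg_of_le_pi le_rfl (by linarith) (by linarith)
    rw [Real.cos_zero] at h3
    linarith
  · have h := re_le_cos_discAngle hP hw (norm_mul_exp hw _) hy hx hx' hne
    linarith

/-! ### The equations of the two coronas and the radii. -/

theorem smallAngleSum_w1s1ss {r s : ℝ} (hs : 0 < s) :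
    smallAngleSum r s w1s1ss = 4 * discAngle 1 s s + Real.pi / 3 := by
  simp [smallAngleSum, w1s1ss, Size.radius, discAngle_self hs, discAngle_comm s s 1]
  ring

theorem smallAngleSum_w1srrs (r s : ℝ) : smallAngleSum r s w1srrs =
    2 * discAngle 1 s s + 2 * discAngle r s s + discAngle r s r := by
  simp [smallAngleSum, w1srrs, Size.radius, discAngle_comm s s 1, discAngle_comm s s r]
  ring

theorem satisfiesSmallCorona_w1s1ss_iff {r s : ℝ} (hs : 0 < s) :
    SatisfiesSmallCorona r s w1s1ss ↔ discAngle 1 s s = 5 * Real.pi / 12 := by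
  unfold SatisfiesSmallCorona
  rw [smallAngleSum_w1s1ss hs]
  constructor <;> intro h <;> linarith

theorem satisfiesSmallCorona_w1srrs_iff {r s : ℝ} : SatisfiesSmallCorona r s w1srrs ↔
    2 * discAngle 1 s s + 2 * discAngle r s s + discAngle r s r = 2 * Real.pi := by
  unfold SatisfiesSmallCorona
  rw [smallAngleSum_w1srrs]

/-- Since cos(5π/12) = sin(π/12), the factor 2 + √3 is cot(π/12). -/
theorem cos_pi_div_twelve_eq : Real.cos (Real.pi / 12) =
    Real.cos (5 * Real.pi / 12) * (2 + √3) := by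
  have e1 : Real.pi / 12 = Real.pi / 3 - Real.pi / 4 := by ring
  have e2 : 5 * Real.pi / 12 = Real.pi / 4 + Real.pi / 6 := by ring
  rw [e1, e2, Real.cos_sub, Real.cos_add, Real.cos_pi_div_three, Real.cos_pi_div_four,
    Real.sin_pi_div_three, Real.sin_pi_div_four, Real.cos_pi_div_six, Real.sin_pi_div_six]
  have : √3 ^ 2 = 3 := Real.sq_sqrt (by norm_num)
  linear_combination (-√2 / 4) * this

theorem cos_five_pi_div_twelve_bounds :
    0.25 < Real.cos (5 * Real.pi / 12) ∧ Real.cos (5 * Real.pi / 12) < 0.26 := by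
  have e2 : 5 * Real.pi / 12 = Real.pi / 4 + Real.pi / 6 := by ring
  have hu : Real.cos (5 * Real.pi / 12) = √2 / 4 * (√3 - 1) := by
    rw [e2, Real.cos_add, Real.cos_pi_div_four, Real.sin_pi_div_four, Real.cos_pi_div_six,
      Real.sin_pi_div_six]
    ring
  have h1 : 1.41 < √2 := Real.lt_sqrt_of_sq_lt (by norm_num)
  have h2 : √2 < 1.42 := (Real.sqrt_lt' (by norm_num)).2 (by norm_num)
  have h3 : 1.732 < √3 := Real.lt_sqrt_of_sq_lt (by norm_num)
  have h4 : √3 < 1.7321 := (Real.sqrt_lt' (by norm_num)).2 (by norm_num)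
  rw [hu]
  constructor <;> nlinarith

/-- The angle at a small disc between tangent neighbors of sizes `x` and `y`. -/
noncomputable def ang (r s : ℝ) (x y : Size) : ℝ := discAngle (x.radius r s) s (y.radius r s)

theorem ang_comm (r s : ℝ) (x y : Size) : ang r s x y = ang r s y x := discAngle_comm _ _ _

theorem discAngle_one_eq_iff {s : ℝ} (hs : 0 < s) :
    discAngle 1 s s = 5 * Real.pi / 12 ↔ s / (1 + s) = Real.cos (5 * Real.pi / 12) := by
  have hpi := Real.pi_pos
  rw [discAngle_self_right one_pos hs]
  constructor
  · intro h
    rw [← h, Real.cos_arccos]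
    · exact (by norm_num : (-1 : ℝ) ≤ 0).trans (by positivity)
    · rw [div_le_one (by positivity)]; linarith
  · intro h
    rw [h, Real.arccos_cos (by positivity) (by linarith)]

/-- The bounds on the angles of small coronas from which the forced neighbors are deduced. -/
theorem ang_bounds {r s : ℝ} (hs : 0 < s) (hsr : s < r) (hr : r < 1)
    (h1 : SatisfiesSmallCorona r s w1srrs) (h2 : SatisfiesSmallCorona r s w1s1ss) :
    ang r s .large .small = 5 * Real.pi / 12 ∧ ang r s .small .small = Real.pi / 3 ∧
    ang r s .medium .medium = 7 * Real.pi / 6 - 2 * ang r s .medium .small ∧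
    Real.pi / 3 < ang r s .medium .small ∧ ang r s .medium .small < 5 * Real.pi / 12 ∧
    Real.pi / 2 < ang r s .large .large ∧ ang r s .large .large < 7 * Real.pi / 12 ∧
    Real.pi / 12 + ang r s .medium .small < ang r s .large .medium ∧
    ang r s .large .medium < 11 * Real.pi / 12 - ang r s .medium .small := by
  have hpi := Real.pi_pos
  have hr0 : 0 < r := hs.trans hsr
  rw [satisfiesSmallCorona_w1srrs_iff] at h1
  rw [satisfiesSmallCorona_w1s1ss_iff hs] at h2
  have hu := (discAngle_one_eq_iff hs).1 h2
  obtain ⟨hu1, hu2⟩ := cos_five_pi_div_twelve_bounds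
  have hC : discAngle r s r = 7 * Real.pi / 6 - 2 * discAngle r s s := by linarith
  have hD1 : Real.pi / 3 < discAngle r s s := by
    rw [← discAngle_self hs]
    exact discAngle_lt_discAngle hs hs hs hsr
  have hD2 : discAngle r s s < 5 * Real.pi / 12 := by
    rw [← h2]
    exact discAngle_lt_discAngle hr0 hs hs hr
  have e1 : 1 / (1 + s) = 1 - Real.cos (5 * Real.pi / 12) := by
    rw [← hu]; field_simp; ring
  have ex : r / (r + s) = 1 - s / (r + s) := by field_simp; ring
  have hcosD : Real.cos (discAngle r s s) = s / (r + s) := by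
    rw [cos_discAngle hr0 hs hs]; field_simp; ring
  have hx1 : s / (r + s) < 1 / 2 := by
    rw [div_lt_div_iff₀ (by positivity) (by norm_num)]; linarith
  have hx2 : Real.cos (5 * Real.pi / 12) < s / (r + s) := by
    rw [← hu]
    exact div_lt_div_of_pos_left hs (by positivity) (by linarith)
  have q1 : 1.732 < √3 := Real.lt_sqrt_of_sq_lt (by norm_num)
  have q2 : √3 < 1.7321 := (Real.sqrt_lt' (by norm_num)).2 (by norm_num)
  have q3 : √3 ^ 2 = 3 := Real.sq_sqrt (by norm_num)
  have hc := cos_pi_div_twelve_eq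
  have hs15 : Real.sin (Real.pi / 12) = Real.cos (5 * Real.pi / 12) := by
    rw [← Real.cos_pi_div_two_sub]; congr 1; ring
  have hc7 : Real.cos (7 * Real.pi / 12) = -Real.cos (5 * Real.pi / 12) := by
    rw [← Real.cos_pi_sub]; congr 1; ring
  refine ⟨h2, discAngle_self hs, hC, hD1, hD2, ?_, ?_, ?_, ?_⟩
  · refine lt_discAngle_of_lt_cos one_pos hs one_pos (by linarith) ?_
    simp only [Size.radius]
    rw [Real.cos_pi_div_two, e1]
    nlinarith
  · refine discAngle_lt_of_cos_lt one_pos hs one_pos (by linarith) ?_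
    simp only [Size.radius]
    rw [hc7, e1]
    nlinarith
  -- This bound will exclude two medium discs in the gap 5π/4 of `nbr_of_large_small`.
  · refine lt_discAngle_of_lt_cos one_pos hs hr0 (by simp only [ang, Size.radius]; linarith) ?_
    simp only [Size.radius, ang]
    rw [Real.cos_add, hcosD, hs15, hc, e1, ex]
    set x := s / (r + s)
    set u := Real.cos (5 * Real.pi / 12)
    have hD0 : 0 ≤ Real.sin (discAngle r s s) :=
      Real.sin_nonneg_of_nonneg_of_le_pi (discAngle_nonneg _ _ _) (discAngle_le_pi _ _ _)
    have hsc := Real.sin_sq_add_cos_sq (discAngle r s s)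
    rw [hcosD] at hsc
    set y := Real.sin (discAngle r s s)
    -- The tangent to the unit circle at (1/2, √3/2), which is the case r = s. It makes the
    -- inequality linear in x, with equality at x = 1/2.
    have hy : y ≤ 2 * √3 / 3 * (1 - x / 2) := by
      nlinarith [sq_nonneg (y - √3 * x)]
    have h3 : u * y ≤ u * (2 * √3 / 3 * (1 - x / 2)) :=
      mul_le_mul_of_nonneg_left hy (by linarith)
    have h4 : 0 < 2 - u * (4 + 4 * √3 / 3) := by nlinarith
    nlinarith [mul_pos (sub_pos.2 hx1) h4]
  -- This bound will exclude a small, a medium and a large disc in succession in the gap 5π/4. The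
  -- sine of half the angle rsr is simply r/(r+s).
  · have h5 : 11 * Real.pi / 12 - ang r s .medium .small =
        Real.pi / 3 + discAngle r s r / 2 := by
      simp only [ang, Size.radius]; linarith
    rw [h5]
    have hC0 := discAngle_nonneg r s r
    have hC1 := discAngle_le_pi r s r
    refine discAngle_lt_of_cos_lt one_pos hs hr0 (by linarith) ?_
    simp only [Size.radius]
    have hcosC := cos_discAngle hr0 hs hr0
    have e3 : discAngle r s r = 2 * (discAngle r s r / 2) := by ring
    rw [e3, Real.cos_two_mul] at hcosC
    have hsc := Real.sin_sq_add_cos_sq (discAngle r s r / 2)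
    have hsin0 : 0 ≤ Real.sin (discAngle r s r / 2) :=
      Real.sin_nonneg_of_nonneg_of_le_pi (by linarith) (by linarith)
    have hcos1 := Real.cos_le_one (discAngle r s r / 2)
    rw [Real.cos_add, Real.cos_pi_div_three, Real.sin_pi_div_three, e1]
    rw [ex] at hcosC ⊢
    have hsin : Real.sin (discAngle r s r / 2) = 1 - s / (r + s) := by
      have : Real.sin (discAngle r s r / 2) ^ 2 = (1 - s / (r + s)) ^ 2 := by
        linear_combination hsc - hcosC / 2
      exact (pow_left_inj₀ hsin0 (by linarith) (by norm_num)).1 this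
    rw [hsin]
    nlinarith

/-- The radii determined by the two small coronas. -/
theorem existsUnique_radii : ∃! p : ℝ × ℝ, (0 < p.2 ∧ p.2 < p.1 ∧ p.1 < 1) ∧
    SatisfiesSmallCorona p.1 p.2 w1srrs ∧ SatisfiesSmallCorona p.1 p.2 w1s1ss := by
  have hpi := Real.pi_pos
  obtain ⟨hu1, hu2⟩ := cos_five_pi_div_twelve_bounds
  set u := Real.cos (5 * Real.pi / 12) with hu
  set s := u / (1 - u) with hsdef
  have h1u : 0 < 1 - u := by linarith
  have hs : 0 < s := by rw [hsdef]; exact div_pos (by linarith) h1u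
  have hs1 : s < 1 := by rw [hsdef, div_lt_one h1u]; linarith
  have hsu : s / (1 + s) = u := by rw [hsdef]; field_simp; ring
  have h2 : discAngle 1 s s = 5 * Real.pi / 12 := (discAngle_one_eq_iff hs).2 hsu
  have e1 : 1 / (1 + s) = 1 - u := by rw [← hsu]; field_simp; ring
  have hA : 5 * Real.pi / 12 < discAngle 1 s 1 := by
    rw [← h2, discAngle_comm 1 s s]
    exact discAngle_lt_discAngle hs hs one_pos hs1
  have hcont : ContinuousOn (fun r => 2 * discAngle r s s + discAngle r s r) (Set.Icc s 1) := by
    unfold discAngle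
    have h0 : ∀ r ∈ Set.Icc s 1, r + s ≠ 0 ∧ s + r ≠ 0 := by
      intro r hr
      have : 0 < r := hs.trans_le hr.1
      constructor <;> positivity
    refine ContinuousOn.add (ContinuousOn.mul continuousOn_const
      (Real.continuous_arccos.comp_continuousOn ?_)) (Real.continuous_arccos.comp_continuousOn ?_)
    · refine ContinuousOn.div (by fun_prop) (by fun_prop) fun r hr => ?_
      simp [h0 r hr, hs.ne']
    · refine ContinuousOn.div (by fun_prop) (by fun_prop) fun r hr => ?_
      simp [h0 r hr]
  -- With the angle 1ss known, 7π/6 is left for 2·rss + rsr. This sum is π at r = s and exceeds 5π/4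
  -- at r = 1.
  obtain ⟨r, hr, hrs⟩ := intermediate_value_Ioo hs1.le hcont
    (show 7 * Real.pi / 6 ∈ Set.Ioo _ _ by
      simp only [discAngle_self hs, h2]
      constructor <;> linarith)
  refine ⟨(r, s), ⟨⟨hs, hr.1, hr.2⟩, ?_, ?_⟩, ?_⟩
  · rw [satisfiesSmallCorona_w1srrs_iff, h2]
    simp only at hrs
    linarith
  · rwa [satisfiesSmallCorona_w1s1ss_iff hs]
  · rintro ⟨r', s'⟩ ⟨⟨hs', hr', hr1'⟩, h3, h4⟩
    simp only at hs' hr' hr1' h3 h4 hrs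
    rw [satisfiesSmallCorona_w1s1ss_iff hs'] at h4
    rw [satisfiesSmallCorona_w1srrs_iff, h4] at h3
    have hs's : s' = s := by
      have h5 := (discAngle_one_eq_iff hs').1 h4
      rw [← hu] at h5
      rw [hsdef, eq_div_iff h1u.ne', ← h5]
      field_simp
      ring
    subst hs's
    have mono : ∀ a b, s < a → a < b → 2 * discAngle a s s + discAngle a s a <
        2 * discAngle b s s + discAngle b s b := by
      intro a b ha hab
      have ha0 := hs.trans ha
      have h6 := discAngle_lt_discAngle ha0 hs hs hab
      have h7 := discAngle_lt_discAngle ha0 hs ha0 hab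
      have h8 := discAngle_lt_discAngle ha0 hs (ha0.trans hab) hab
      rw [discAngle_comm a s b] at h8
      linarith
    rcases lt_trichotomy r' r with h6 | rfl | h6
    · have := mono _ _ hr' h6; linarith
    · rfl
    · have := mono _ _ hr.1 h6; linarith

theorem Size.le_radius {r s : ℝ} (hsr : s < r) (hr : r < 1) (x : Size) : s ≤ x.radius r s := by
  cases x <;> simp only [Size.radius] <;> linarith

/-! ### Forced neighbors of a small disc. -/

/-- The radii and packings for which the small corona `1s1ss` forces the packing. -/
structure IsSpecial (r s : ℝ) (P : Set Disc) : Prop where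
  small_pos : 0 < s
  small_lt : s < r
  medium_lt : r < 1
  equation_w1srrs : SatisfiesSmallCorona r s w1srrs
  equation_w1s1ss : SatisfiesSmallCorona r s w1s1ss
  isCompactPacking : IsCompactPacking P
  hasSizes : HasSizes r s P

/-- The disc of `P` of size `x` which touches, in the direction `w`, the small disc centered at
`z`. -/
def Nbr (P : Set Disc) (r s : ℝ) (z w : ℂ) (x : Size) : Prop :=
  HasDisc P (z + (s + x.radius r s : ℝ) * w) (x.radius r s)

/-- The rotation of angle `θ` and sense `σ`. -/
noncomputable def rot (σ θ : ℝ) : ℂ := Complex.exp ((σ * θ : ℝ) * Complex.I)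

theorem rot_add (σ θ θ' : ℝ) : rot σ (θ + θ') = rot σ θ * rot σ θ' := by
  unfold rot
  rw [← Complex.exp_add]
  congr 1
  push_cast
  ring

namespace IsSpecial

variable {r s : ℝ} {P : Set Disc}

theorem le_radius (h : IsSpecial r s P) : ∀ d ∈ P, s ≤ d.radius := by
  intro d hd
  obtain ⟨x, hx⟩ := h.hasSizes d hd
  rw [hx]
  exact x.le_radius h.small_lt h.medium_lt

theorem exists_next (h : IsSpecial r s P) {z w : ℂ} {σ θ : ℝ} {x : Size} (hz : HasDisc P z s)
    (hw : ‖w‖ = 1) (hσ : σ = 1 ∨ σ = -1) (hx : Nbr P r s z (w * rot σ θ) x) :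
    ∃ y, Nbr P r s z (w * rot σ (θ + ang r s x y)) y := by
  unfold Nbr at hx
  rw [Complex.ofReal_add] at hx
  obtain ⟨ρ, hρ⟩ := h.isCompactPacking.exists_next h.small_pos h.le_radius
    (norm_mul_exp hw _) hz hx hσ
  have hρ' := hρ
  obtain ⟨d, hd, -, hdr⟩ := hρ'
  obtain ⟨y, hy⟩ := h.hasSizes d hd
  obtain rfl : ρ = y.radius r s := by rw [← hdr, hy]
  refine ⟨y, ?_⟩
  unfold Nbr
  rw [Complex.ofReal_add, rot_add, ← mul_assoc w]
  exact hρ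

theorem false_of_angle (h : IsSpecial r s P) {z w : ℂ} {σ θ : ℝ} {x y : Size}
    (hw : ‖w‖ = 1) (hσ : σ = 1 ∨ σ = -1) (hx : Nbr P r s z w x)
    (hy : Nbr P r s z (w * rot σ θ) y) (h1 : 2 * Real.pi - ang r s x y < θ)
    (h2 : θ < 2 * Real.pi) : False := by
  unfold Nbr at hx hy
  rw [Complex.ofReal_add] at hx hy
  exact not_hasDisc_of_angle h.isCompactPacking.1 hw h.small_pos hx hσ h1 h2 hy

/-- Between two large neighbors which face a gap `7π/6`, a small disc has two small neighbors. -/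
theorem nbr_of_large_large (h : IsSpecial r s P) {z w : ℂ} {σ : ℝ} (hz : HasDisc P z s)
    (hw : ‖w‖ = 1) (hσ : σ = 1 ∨ σ = -1) (h0 : Nbr P r s z w .large)
    (h1 : Nbr P r s z (w * rot σ (5 * Real.pi / 6)) .large) :
    Nbr P r s z (w * rot σ (5 * Real.pi / 4)) .small ∧
      Nbr P r s z (w * rot σ (19 * Real.pi / 12)) .small := by
  have hpi := Real.pi_pos
  obtain ⟨a1, a2, a3, a4, a5, a6, a7, a8, a9⟩ := ang_bounds h.small_pos h.small_lt h.medium_lt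
    h.equation_w1srrs h.equation_w1s1ss
  have c1 := ang_comm r s .medium .large
  have c2 := ang_comm r s .small .large
  have c3 := ang_comm r s .small .medium
  obtain ⟨x, hx⟩ := h.exists_next hz hw hσ h1
  obtain ⟨y, hy⟩ := h.exists_next hz hw hσ hx
  cases x <;> cases y
  -- The gap is filled exactly: 7π/6 = 5π/12 + π/3 + 5π/12.
  case small.small =>
    rw [a1] at hx
    rw [a1, a2] at hy
    exact ⟨by convert hx using 3; ring, by convert hy using 3; ring⟩
  -- Otherwise the second new disc stops short of the full turn, but too close to the first large
  -- disc.
  all_goals exact (h.false_of_angle hw hσ h0 hy (by linarith) (by linarith)).elim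

/-- If a small disc has a large and a small neighbor which face a gap `5π/4`, then further
neighbors are large and small. -/
theorem nbr_of_large_small (h : IsSpecial r s P) {z w : ℂ} {σ : ℝ} (hz : HasDisc P z s)
    (hw : ‖w‖ = 1) (hσ : σ = 1 ∨ σ = -1) (h0 : Nbr P r s z w .large)
    (h1 : Nbr P r s z (w * rot σ (3 * Real.pi / 4)) .small) :
    Nbr P r s z (w * rot σ (7 * Real.pi / 6)) .large ∧
      Nbr P r s z (w * rot σ (19 * Real.pi / 12)) .small := by
  have hpi := Real.pi_pos
  obtain ⟨a1, a2, a3, a4, a5, a6, a7, a8, a9⟩ := ang_bounds h.small_pos h.small_lt h.medium_lt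
    h.equation_w1srrs h.equation_w1s1ss
  have c1 := ang_comm r s .medium .large
  have c2 := ang_comm r s .small .large
  have c3 := ang_comm r s .small .medium
  obtain ⟨x, hx⟩ := h.exists_next hz hw hσ h1
  obtain ⟨y, hy⟩ := h.exists_next hz hw hσ hx
  obtain ⟨v, hv⟩ := h.exists_next hz hw hσ hy
  cases x <;> cases y
  case large.small =>
    rw [c2, a1] at hx
    rw [c2, a1] at hy
    exact ⟨by convert hx using 3; ring, by convert hy using 3; linarith⟩
  case large.large => exact (h.false_of_angle hw hσ h0 hy (by linarith) (by linarith)).elim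
  case large.medium => exact (h.false_of_angle hw hσ h0 hy (by linarith) (by linarith)).elim
  case medium.large => exact (h.false_of_angle hw hσ h0 hy (by linarith) (by linarith)).elim
  case medium.medium => exact (h.false_of_angle hw hσ h0 hy (by linarith) (by linarith)).elim
  case small.large => exact (h.false_of_angle hw hσ h0 hy (by linarith) (by linarith)).elim
  -- When the two new discs are ss, rs or sr, the overlap appears with the third one.
  all_goals
    cases v <;> exact (h.false_of_angle hw hσ h0 hv (by linarith) (by linarith)).elim

end IsSpecial

/-! ### Good small discs and how they propagate. -/

/-- The primitive 24th root of unity of argument `π / 12`. -/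
noncomputable def zeta : ℂ := Complex.exp ((Real.pi / 12 : ℝ) * Complex.I)

theorem zeta_pow (k : ℕ) : zeta ^ k = Complex.exp ((k * (Real.pi / 12) : ℝ) * Complex.I) := by
  unfold zeta
  rw [← Complex.exp_nat_mul]
  congr 1
  push_cast
  ring

theorem norm_zeta : ‖zeta‖ = 1 := Complex.norm_exp_ofReal_mul_I _

theorem norm_zeta_pow (k : ℕ) : ‖zeta ^ k‖ = 1 := by rw [norm_pow, norm_zeta, one_pow]

theorem zeta_pow_four : zeta ^ 4 = ⟨1 / 2, √3 / 2⟩ := by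
  rw [zeta_pow]
  have e : ((4 : ℕ) : ℝ) * (Real.pi / 12) = Real.pi / 3 := by push_cast; ring
  rw [e]
  apply Complex.ext
  · rw [Complex.exp_ofReal_mul_I_re, Real.cos_pi_div_three]
  · rw [Complex.exp_ofReal_mul_I_im, Real.sin_pi_div_three]

/-- The minimal equation of the sixth root of unity `zeta ^ 4`. Together with `two_mul_eq` it
reduces coincidences of centers to polynomial identities. -/
theorem zeta_pow_eight : zeta ^ 8 = zeta ^ 4 - 1 := by
  have h4 := zeta_pow_four
  have h3 : √3 * √3 = 3 := Real.mul_self_sqrt (by norm_num)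
  have : zeta ^ 8 = zeta ^ 4 * zeta ^ 4 := by ring
  rw [this, h4]
  apply Complex.ext
  · simp only [Complex.mul_re, Complex.sub_re, Complex.one_re]
    linear_combination (-1 / 4) * h3
  · simp only [Complex.mul_im, Complex.sub_im, Complex.one_im]
    ring

theorem zeta_pow_twelve : zeta ^ 12 = -1 := by
  linear_combination (zeta ^ 4 + 1) * zeta_pow_eight

theorem rot_one_eq_zeta_pow {θ : ℝ} (k : ℕ) (h : θ = k * (Real.pi / 12)) :
    rot 1 θ = zeta ^ k := by
  rw [zeta_pow, rot, one_mul, h]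

theorem rot_neg_one_eq_zeta_pow {θ : ℝ} (k l : ℕ) (h : θ = k * (Real.pi / 12)) (hkl : k + l = 24) :
    rot (-1) θ = zeta ^ l := by
  have h1 : rot (-1) θ * zeta ^ k = 1 := by
    rw [zeta_pow, rot, ← Complex.exp_add, h]
    simp
  have h2 : zeta ^ k * zeta ^ l = 1 := by
    rw [← pow_add, hkl]
    linear_combination (zeta ^ 12 - 1) * zeta_pow_twelve
  have h3 : zeta ^ k ≠ 0 := left_ne_zero_of_mul_eq_one h2
  exact mul_right_cancel₀ h3 (by rw [h1, mul_comm, h2])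

/-- The small disc of `P` centered at `z` has the corona `1s1ss`, starting in the direction `u` and
counterclockwise. -/
structure IsGood (P : Set Disc) (r s : ℝ) (z u : ℂ) : Prop where
  center : HasDisc P z s
  nbr_zero : Nbr P r s z u .large
  nbr_five : Nbr P r s z (u * zeta ^ 5) .small
  nbr_ten : Nbr P r s z (u * zeta ^ 10) .large
  nbr_fifteen : Nbr P r s z (u * zeta ^ 15) .small
  nbr_nineteen : Nbr P r s z (u * zeta ^ 19) .small

theorem HasDisc.congr {P : Set Disc} {z z' : ℂ} {ρ : ℝ} (h : HasDisc P z ρ) (e : z = z') :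
    HasDisc P z' ρ := e ▸ h

theorem IsGood.congr {P : Set Disc} {r s : ℝ} {z z' u u' : ℂ} (h : IsGood P r s z u)
    (e : z = z') (e' : u = u') : IsGood P r s z' u' := e ▸ e' ▸ h

namespace IsSpecial

variable {r s : ℝ} {P : Set Disc}

theorem div_eq_cos (h : IsSpecial r s P) : s / (1 + s) = Real.cos (5 * Real.pi / 12) :=
  (discAngle_one_eq_iff h.small_pos).1
    ((satisfiesSmallCorona_w1s1ss_iff h.small_pos).1 h.equation_w1s1ss)

/-- A large disc and two small ones, mutually tangent, form an isosceles triangle with legs 1+s,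
base 2s and base angles 5π/12. -/
theorem two_mul_eq (h : IsSpecial r s P) :
    2 * (s : ℂ) = (1 + s) * (zeta ^ 5 - zeta ^ 7) := by
  have h1 : zeta ^ 5 - zeta ^ 7 = ((2 * Real.cos (5 * Real.pi / 12) : ℝ) : ℂ) := by
    rw [zeta_pow, zeta_pow]
    have e1 : ((5 : ℕ) : ℝ) * (Real.pi / 12) = 5 * Real.pi / 12 := by push_cast; ring
    have e2 : ((7 : ℕ) : ℝ) * (Real.pi / 12) = Real.pi - 5 * Real.pi / 12 := by push_cast; ring
    rw [e1, e2]
    apply Complex.ext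
    · rw [Complex.sub_re, Complex.exp_ofReal_mul_I_re, Complex.exp_ofReal_mul_I_re,
        Real.cos_pi_sub, Complex.ofReal_re]
      ring
    · rw [Complex.sub_im, Complex.exp_ofReal_mul_I_im, Complex.exp_ofReal_mul_I_im,
        Real.sin_pi_sub, Complex.ofReal_im]
      ring
  have hs := h.small_pos
  rw [h1, ← h.div_eq_cos]
  have h2 : (1 + (s : ℂ)) ≠ 0 := by exact_mod_cast (by positivity : 1 + s ≠ 0)
  push_cast
  field_simp

theorem isGood_of_nbr (h : IsSpecial r s P) {z u : ℂ} (hu : ‖u‖ = 1) (hz : HasDisc P z s)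
    (h0 : Nbr P r s z u .large) (h5 : Nbr P r s z (u * zeta ^ 5) .small)
    (h10 : Nbr P r s z (u * zeta ^ 10) .large) : IsGood P r s z u := by
  have := h.nbr_of_large_large hz hu (.inl rfl) h0
    (by rwa [rot_one_eq_zeta_pow 10 (by push_cast; ring)])
  rw [rot_one_eq_zeta_pow 15 (by push_cast; ring),
    rot_one_eq_zeta_pow 19 (by push_cast; ring)] at this
  exact ⟨hz, h0, h5, h10, this.1, this.2⟩

/-- The small disc between two large neighbors of a good disc is good. -/
theorem isGood_five (h : IsSpecial r s P) {z u : ℂ} (hu : ‖u‖ = 1) (hg : IsGood P r s z u) :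
    IsGood P r s (z + 2 * s * u * zeta ^ 5) (-u) := by
  have h8 := zeta_pow_eight
  have hs := h.two_mul_eq
  refine h.isGood_of_nbr (by rwa [norm_neg]) ?_ ?_ ?_ ?_
  · refine hg.nbr_five.congr ?_
    simp only [Size.radius]; push_cast; ring
  · refine hg.nbr_ten.congr ?_
    simp only [Size.radius]; push_cast
    linear_combination (-(u * zeta ^ 5)) * hs + (1 + s) * u * (1 + zeta ^ 4) * h8
  · refine hg.center.congr ?_
    simp only [Size.radius]; push_cast; ring
  · refine hg.nbr_zero.congr ?_
    simp only [Size.radius]; push_cast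
    linear_combination (-(u * zeta ^ 5)) * hs + (1 + s) * u * (1 + zeta ^ 4) * h8

/-- The small disc next to a large and a small neighbor of a good disc is good. -/
theorem isGood_fifteen (h : IsSpecial r s P) {z u : ℂ} (hu : ‖u‖ = 1) (hg : IsGood P r s z u) :
    IsGood P r s (z + 2 * s * u * zeta ^ 15) (u * zeta ^ 8) := by
  have h8 := zeta_pow_eight
  have h12 := zeta_pow_twelve
  have hs := h.two_mul_eq
  have hu' : ‖u * zeta ^ 8‖ = 1 := by rw [norm_mul, hu, norm_zeta_pow, one_mul]
  have hz : HasDisc P (z + 2 * s * u * zeta ^ 15) s := by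
    refine hg.nbr_fifteen.congr ?_
    simp only [Size.radius]; push_cast; ring
  have h0 : Nbr P r s (z + 2 * s * u * zeta ^ 15) (u * zeta ^ 8) .large := by
    refine hg.nbr_ten.congr ?_
    simp only [Size.radius]; push_cast
    linear_combination (-(u * zeta ^ 15)) * hs - (1 + s) * u * zeta ^ 8 * (1 - zeta ^ 2) * h12
  have h15 : Nbr P r s (z + 2 * s * u * zeta ^ 15) (u * zeta ^ 8 * zeta ^ 15) .small := by
    refine hg.nbr_nineteen.congr ?_
    simp only [Size.radius]; push_cast
    linear_combination (-(2 * s * u * zeta ^ 15)) * h8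
  have h19 : Nbr P r s (z + 2 * s * u * zeta ^ 15) (u * zeta ^ 8 * zeta ^ 19) .small := by
    refine hg.center.congr ?_
    simp only [Size.radius]; push_cast
    linear_combination (-(2 * s * u * zeta ^ 15)) * h12
  -- The known discs are reached clockwise from the large one; a clockwise turn by k steps of π/12
  -- is the power 24 − k.
  have r9 : rot (-1) (3 * Real.pi / 4) = zeta ^ 15 :=
    rot_neg_one_eq_zeta_pow 9 15 (by push_cast; ring) (by norm_num)
  have r14 : rot (-1) (7 * Real.pi / 6) = zeta ^ 10 :=
    rot_neg_one_eq_zeta_pow 14 10 (by push_cast; ring) (by norm_num)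
  have r19 : rot (-1) (19 * Real.pi / 12) = zeta ^ 5 :=
    rot_neg_one_eq_zeta_pow 19 5 (by push_cast; ring) (by norm_num)
  have := h.nbr_of_large_small hz hu' (.inr rfl) h0 (by rw [r9]; exact h15)
  rw [r14, r19] at this
  exact ⟨hz, h0, this.2, this.1, h15, h19⟩

end IsSpecial

/-! ### The lattice of large discs and their small neighbors. -/

/-- The large disc centered at `x` touches a good small disc, from which it is seen in the
direction `u`. -/
def IsHub (P : Set Disc) (r s : ℝ) (x u : ℂ) : Prop := IsGood P r s (x - (1 + s) * u) u

theorem IsHub.congr {P : Set Disc} {r s : ℝ} {x x' u u' : ℂ} (h : IsHub P r s x u)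
    (e : x = x') (e' : u = u') : IsHub P r s x' u' := e ▸ e' ▸ h

theorem IsHub.hasDisc {P : Set Disc} {r s : ℝ} {x u : ℂ} (h : IsHub P r s x u) :
    HasDisc P x 1 := by
  refine h.nbr_zero.congr ?_
  simp only [Size.radius]; push_cast; ring

namespace IsSpecial

variable {r s : ℝ} {P : Set Disc}

/-- The moves `isGood_five` and `isGood_fifteen` in succession stay around the same large disc and
turn the pattern by −π/3. -/
theorem isHub_rotate (h : IsSpecial r s P) {x u : ℂ} (hu : ‖u‖ = 1) (hx : IsHub P r s x u) :
    IsHub P r s x (u * zeta ^ 20) := by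
  have h8 := zeta_pow_eight
  have h12 := zeta_pow_twelve
  have hs := h.two_mul_eq
  refine (h.isGood_fifteen (by rwa [norm_neg]) (h.isGood_five hu hx)).congr ?_ ?_
  · linear_combination (u * zeta ^ 5 - u * zeta ^ 15) * hs -
      (1 + s) * u * (1 - zeta ^ 10) * h12
  · linear_combination (-(u * zeta ^ 8)) * h12

theorem isHub_rotate_pow (h : IsSpecial r s P) {x u : ℂ} (hu : ‖u‖ = 1) (hx : IsHub P r s x u)
    (k : ℕ) : IsHub P r s x (u * zeta ^ (20 * k)) := by
  induction k with
  | zero => simpa using hx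
  | succ k ih =>
    refine (h.isHub_rotate (by rw [norm_mul, hu, norm_zeta_pow, one_mul]) ih).congr rfl ?_
    ring

/-- Five turns by −π/3 make one turn by π/3: 100 is 4 modulo 24. -/
theorem isHub_rotate_pow' (h : IsSpecial r s P) {x u : ℂ} (hu : ‖u‖ = 1) (hx : IsHub P r s x u)
    (k : ℕ) : IsHub P r s x (u * zeta ^ (4 * k)) := by
  refine (h.isHub_rotate_pow hu hx (5 * k)).congr rfl ?_
  have : zeta ^ 100 = zeta ^ 4 := by
    have : zeta ^ 100 = (zeta ^ 12) ^ 8 * zeta ^ 4 := by ring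
    rw [this, zeta_pow_twelve]; norm_num
  rw [← mul_assoc, show 20 * 5 = 100 from rfl, pow_mul, this, pow_mul]

/-- The partner found by `isGood_five` sees the other large disc in the direction −u; three turns by
π/3 restore u. -/
theorem isHub_translate (h : IsSpecial r s P) {x u : ℂ} (hu : ‖u‖ = 1) (hx : IsHub P r s x u) :
    IsHub P r s (x + (1 + s) * u * (zeta ^ 10 - 1)) u := by
  have h8 := zeta_pow_eight
  have h12 := zeta_pow_twelve
  have hs := h.two_mul_eq
  have h1 : IsHub P r s (x + (1 + s) * u * (zeta ^ 10 - 1)) (-u) := by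
    refine (h.isGood_five hu hx).congr ?_ rfl
    linear_combination (u * zeta ^ 5) * hs - (1 + s) * u * h12
  refine (h.isHub_rotate_pow' (by rwa [norm_neg]) h1 3).congr rfl ?_
  linear_combination (-u) * h12

/-- Rotate, translate, then rotate on to complete k full turns: 4k + 20k = 24k. -/
theorem isHub_translate_pow (h : IsSpecial r s P) {x u : ℂ} (hu : ‖u‖ = 1)
    (hx : IsHub P r s x u) (k : ℕ) :
    IsHub P r s (x + (1 + s) * u * (zeta ^ 10 - 1) * zeta ^ (4 * k)) u := by
  have h1 := h.isHub_translate (by rw [norm_mul, hu, norm_zeta_pow, one_mul])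
    (h.isHub_rotate_pow' hu hx k)
  refine (h.isHub_rotate_pow' (by rw [norm_mul, hu, norm_zeta_pow, one_mul]) h1 (5 * k)).congr
    (by ring) ?_
  have : zeta ^ (4 * k) * zeta ^ (4 * (5 * k)) = (zeta ^ 12 * zeta ^ 12) ^ k := by ring
  rw [mul_assoc, this, zeta_pow_twelve]
  norm_num

/-- The values k = 0, 1, 3, 4 give steps along 1, `zeta ^ 4` and their opposites. -/
theorem isHub_lattice (h : IsSpecial r s P) {x u : ℂ} (hu : ‖u‖ = 1) (hx : IsHub P r s x u)
    (m n : ℤ) : IsHub P r s (x + m * ((1 + s) * u * (zeta ^ 10 - 1)) +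
      n * ((1 + s) * u * (zeta ^ 10 - 1) * zeta ^ 4)) u := by
  have h12 := zeta_pow_twelve
  have h1 : ∀ m : ℤ, IsHub P r s (x + m * ((1 + s) * u * (zeta ^ 10 - 1))) u := by
    intro m
    induction m with
    | zero => simpa using hx
    | succ m ih =>
      refine (h.isHub_translate_pow hu ih 0).congr ?_ rfl
      push_cast; ring
    | pred m ih =>
      refine (h.isHub_translate_pow hu ih 3).congr ?_ rfl
      push_cast
      linear_combination (1 + s) * u * (zeta ^ 10 - 1) * h12
  induction n with
  | zero => simpa using h1 m
  | succ n ih =>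
    refine (h.isHub_translate_pow hu ih 1).congr ?_ rfl
    push_cast; ring
  | pred n ih =>
    refine (h.isHub_translate_pow hu ih 4).congr ?_ rfl
    push_cast
    linear_combination (1 + s) * u * (zeta ^ 10 - 1) * zeta ^ 4 * h12

/-- Even directions come from the rotated good discs, odd ones from their partners under
`isGood_five`. The shift i + 3 is a half-turn, as a hub direction points from the small disc to the
large one. -/
theorem hasDisc_small (h : IsSpecial r s P) {x u : ℂ} (hu : ‖u‖ = 1) (hx : IsHub P r s x u)
    (j : ℕ) : HasDisc P (x + (1 + s) * (u * zeta ^ (2 * j))) s := by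
  have h12 := zeta_pow_twelve
  have h24 : zeta ^ 24 = 1 := by linear_combination (zeta ^ 12 - 1) * h12
  obtain ⟨i, rfl | rfl⟩ := j.even_or_odd'
  · refine (h.isHub_rotate_pow' hu hx (i + 3)).center.congr ?_
    have : zeta ^ (4 * (i + 3)) = zeta ^ (2 * (2 * i)) * zeta ^ 12 := by ring
    rw [this]
    linear_combination (-(1 + s) * (u * zeta ^ (2 * (2 * i)))) * h12
  · refine (h.isGood_five (by rw [norm_mul, hu, norm_zeta_pow, one_mul])
      (h.isHub_rotate_pow' hu hx (i + 4))).center.congr ?_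
    have : zeta ^ (4 * (i + 4)) = zeta ^ (2 * (2 * i)) * zeta ^ 16 := by ring
    have e2 : zeta ^ (2 * (2 * i + 1)) = zeta ^ (2 * (2 * i)) * zeta ^ 2 := by ring
    rw [this, e2]
    have hs := h.two_mul_eq
    linear_combination u * zeta ^ (2 * (2 * i)) * (zeta ^ 21 * hs +
      (1 + s) * (zeta ^ 2 * h24 - zeta ^ 16 * h12))

end IsSpecial

/-! ### Absence of further discs. -/

/-- The form is the squared length in the basis 1, `zeta ^ 4`, and 1/3 is the squared circumradius
of the unit equilateral triangle. -/
theorem exists_int_hexagonal_le (x y : ℝ) : ∃ m n : ℤ,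
    (x - m) ^ 2 + (x - m) * (y - n) + (y - n) ^ 2 ≤ 1 / 3 := by
  have hx0 := Int.fract_nonneg x
  have hx1 := (Int.fract_lt_one x).le
  have hy0 := Int.fract_nonneg y
  have hy1 := (Int.fract_lt_one y).le
  have ex : ∀ k : ℤ, x - (⌊x⌋ + k : ℤ) = Int.fract x - k := by
    intro k; rw [Int.fract]; push_cast; ring
  have ey : ∀ k : ℤ, y - (⌊y⌋ + k : ℤ) = Int.fract y - k := by
    intro k; rw [Int.fract]; push_cast; ring
  suffices ∃ m n : ℤ, (Int.fract x - m) ^ 2 + (Int.fract x - m) * (Int.fract y - n) +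
      (Int.fract y - n) ^ 2 ≤ 1 / 3 by
    obtain ⟨m, n, h⟩ := this
    exact ⟨⌊x⌋ + m, ⌊y⌋ + n, by rwa [ex, ey]⟩
  generalize Int.fract x = a at *
  generalize Int.fract y = b at *
  by_contra! hcon
  have h00 := hcon 0 0
  have h10 := hcon 1 0
  have h01 := hcon 0 1
  have h11 := hcon 1 1
  push_cast at h00 h10 h01 h11
  -- Each half of the unit cell is a triangle. Averaged with the barycentric weights, the squared
  -- distances to the vertices give the squared circumradius minus the squared distance to the
  -- circumcenter.
  rcases le_total (a + b) 1 with hab | hab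
  · nlinarith [mul_le_mul_of_nonneg_left h00.le (sub_nonneg.2 hab),
      mul_le_mul_of_nonneg_left h10.le hx0, mul_le_mul_of_nonneg_left h01.le hy0,
      sq_nonneg (a - b), sq_nonneg (1 - a - b - a), sq_nonneg (1 - a - b - b),
      sq_nonneg (a + b - 2 / 3), sq_nonneg (a - 1 / 3), sq_nonneg (b - 1 / 3)]
  · nlinarith [mul_le_mul_of_nonneg_left h11.le (sub_nonneg.2 hab),
      mul_le_mul_of_nonneg_left h10.le (sub_nonneg.2 hy1),
      mul_le_mul_of_nonneg_left h01.le (sub_nonneg.2 hx1),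
      sq_nonneg (a - b), sq_nonneg (a + b - 1 - (1 - a)), sq_nonneg (a + b - 1 - (1 - b)),
      sq_nonneg (a + b - 4 / 3), sq_nonneg (a - 2 / 3), sq_nonneg (b - 2 / 3)]

/-- Every direction is within `π / 12` of one of the twelve directions `zeta ^ (2 * j)`. -/
theorem exists_cos_le_re (w : ℂ) (hw : ‖w‖ = 1) :
    ∃ j : ℕ, Real.cos (Real.pi / 12) ≤ ((starRingEnd ℂ) (zeta ^ (2 * j)) * w).re := by
  have hpi := Real.pi_pos
  -- The shift makes the angle positive, so that a natural floor rounds it to a multiple of π/6.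
  set θ := Complex.arg w + 2 * Real.pi with hθ
  have hθ0 : 0 < θ := by linarith [Complex.neg_pi_lt_arg w]
  have hwθ : w = Complex.exp (θ * Complex.I) := by
    have := Complex.norm_mul_exp_arg_mul_I w
    rw [hw, Complex.ofReal_one, one_mul] at this
    rw [hθ]
    push_cast
    rw [add_mul, Complex.exp_add, Complex.exp_two_pi_mul_I, mul_one, this]
  set j := ⌊θ * 6 / Real.pi + 1 / 2⌋₊ with hj
  have h1 : (j : ℝ) ≤ θ * 6 / Real.pi + 1 / 2 := Nat.floor_le (by positivity)
  have h2 : θ * 6 / Real.pi + 1 / 2 < j + 1 := Nat.lt_floor_add_one _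
  have h3 : (j - 1 / 2) * Real.pi ≤ θ * 6 := by
    rw [← le_div_iff₀ hpi]; linarith
  have h4 : θ * 6 < (j + 1 / 2) * Real.pi := by
    rw [← div_lt_iff₀ hpi]; linarith
  refine ⟨j, ?_⟩
  have e : (starRingEnd ℂ) (zeta ^ (2 * j)) * w =
      Complex.exp (((θ - j * Real.pi / 6 : ℝ) : ℂ) * Complex.I) := by
    rw [zeta_pow, hwθ, ← Complex.exp_conj, ← Complex.exp_add]
    congr 1
    simp only [map_mul, Complex.conj_I, Complex.conj_ofReal]
    push_cast
    ring
  rw [e, Complex.exp_ofReal_mul_I_re, ← Real.cos_abs (θ - _)]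
  refine Real.cos_le_cos_of_nonneg_of_le_pi (abs_nonneg _) (by linarith) ?_
  rw [abs_le]
  constructor <;> linarith

theorem re_conj_zeta_pow_mul (i j : ℕ) : ((starRingEnd ℂ) (zeta ^ i) * zeta ^ j).re =
    Real.cos ((i - j) * (Real.pi / 12)) := by
  rw [zeta_pow, zeta_pow, ← Complex.exp_conj, ← Complex.exp_add]
  have e : (starRingEnd ℂ) (((i * (Real.pi / 12) : ℝ) : ℂ) * Complex.I) +
      ((j * (Real.pi / 12) : ℝ) : ℂ) * Complex.I =
      ((-((i - j) * (Real.pi / 12)) : ℝ) : ℂ) * Complex.I := by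
    simp only [map_mul, Complex.conj_I, Complex.conj_ofReal]
    push_cast
    ring
  rw [e, Complex.exp_ofReal_mul_I_re, Real.cos_neg]

theorem conj_mul_mul_mul {u : ℂ} (hu : ‖u‖ = 1) (a b : ℂ) :
    (starRingEnd ℂ) (u * a) * (u * b) = (starRingEnd ℂ) a * b := by
  have : (starRingEnd ℂ) u * u = 1 := by
    rw [mul_comm, Complex.mul_conj, Complex.normSq_eq_norm_sq, hu]; simp
  rw [map_mul]
  linear_combination ((starRingEnd ℂ) a * b) * this

theorem cos_pi_div_twelve_gt : 0.96 < Real.cos (Real.pi / 12) := by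
  have h := cos_pi_div_twelve_eq
  have h1 := Real.sin_sq_add_cos_sq (Real.pi / 12)
  have hs15 : Real.sin (Real.pi / 12) = Real.cos (5 * Real.pi / 12) := by
    rw [← Real.cos_pi_div_two_sub]; congr 1; ring
  obtain ⟨hu1, hu2⟩ := cos_five_pi_div_twelve_bounds
  have hc : 0 ≤ Real.cos (Real.pi / 12) := by rw [h]; positivity
  rw [hs15] at h1
  nlinarith

/-- The vector from a large disc to another one in the packing. -/
noncomputable def latticeVector (s : ℝ) (u : ℂ) : ℂ := (1 + s) * u * (zeta ^ 10 - 1)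

theorem sq_norm_latticeVector {s : ℝ} {u : ℂ} (hu : ‖u‖ = 1) :
    ‖latticeVector s u‖ ^ 2 = (1 + s) ^ 2 * (2 + √3) := by
  have h1 := sq_norm_mul_sub_mul (norm_zeta_pow 10) (norm_zeta_pow 0) 1 1
  rw [re_conj_zeta_pow_mul, pow_zero, mul_one, Complex.ofReal_one, one_mul] at h1
  have h2 : Real.cos ((((10 : ℕ) : ℝ) - ((0 : ℕ) : ℝ)) * (Real.pi / 12)) = -(√3 / 2) := by
    rw [← Real.cos_pi_div_six, ← Real.cos_pi_sub]; congr 1; push_cast; ring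
  rw [h2] at h1
  rw [latticeVector, norm_mul, norm_mul, hu, mul_one, mul_pow, h1, ← Complex.ofReal_one,
    ← Complex.ofReal_add, Complex.norm_real, Real.norm_eq_abs, sq_abs]
  ring

theorem latticeVector_ne_zero {s : ℝ} (hs : 0 < s) {u : ℂ} (hu : ‖u‖ = 1) :
    latticeVector s u ≠ 0 := by
  intro h0
  have h1 := sq_norm_latticeVector (s := s) hu
  rw [h0, norm_zero, zero_pow two_ne_zero] at h1
  have h2 : 0 < (1 + s) ^ 2 * (2 + √3) := by positivity
  exact h2.ne h1

/-- The points of the triangular lattice. -/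
noncomputable def latticePoint (s : ℝ) (x u : ℂ) (m n : ℤ) : ℂ :=
  x + m * latticeVector s u + n * (latticeVector s u * zeta ^ 4)

theorem sq_norm_add_mul_zeta (a b : ℝ) : ‖(a : ℂ) + b * zeta ^ 4‖ ^ 2 = a ^ 2 + a * b + b ^ 2 := by
  have h1 := sq_norm_mul_sub_mul (norm_zeta_pow 0) (norm_zeta_pow 4) a (-b)
  rw [re_conj_zeta_pow_mul] at h1
  have h2 : Real.cos ((((0 : ℕ) : ℝ) - ((4 : ℕ) : ℝ)) * (Real.pi / 12)) = 1 / 2 := by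
    rw [← Real.cos_pi_div_three, ← Real.cos_neg]; congr 1; push_cast; ring
  rw [h2] at h1
  have e : (a : ℂ) * zeta ^ 0 - ((-b : ℝ) : ℂ) * zeta ^ 4 = a + b * zeta ^ 4 := by
    push_cast; ring
  rw [e] at h1
  rw [h1]
  ring

theorem exists_eq_add_mul_zeta (ξ : ℂ) : ∃ a b : ℝ, ξ = a + b * zeta ^ 4 := by
  have h4 := zeta_pow_four
  have h3 : √3 ≠ 0 := by positivity
  refine ⟨ξ.re - ξ.im / √3, 2 * ξ.im / √3, ?_⟩
  rw [h4]
  apply Complex.ext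
  · simp
    field_simp
    ring
  · simp
    field_simp

/-- The covering radius is √((2+√3)/3)·(1+s), about 1.115(1+s); the rounded constant is good enough.
-/
theorem exists_latticePoint_near {s : ℝ} (hs : 0 < s) {x u : ℂ} (hu : ‖u‖ = 1) (c : ℂ) :
    ∃ m n : ℤ, ‖c - latticePoint s x u m n‖ ≤ (1 + s) * 1.2 := by
  have hp := sq_norm_latticeVector (s := s) hu
  have hp0 := latticeVector_ne_zero hs hu
  obtain ⟨a, b, hab⟩ := exists_eq_add_mul_zeta ((c - x) / latticeVector s u)
  obtain ⟨m, n, hmn⟩ := exists_int_hexagonal_le a b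
  refine ⟨m, n, ?_⟩
  have e : c - latticePoint s x u m n =
      latticeVector s u * (((a - m : ℝ) : ℂ) + ((b - n : ℝ) : ℂ) * zeta ^ 4) := by
    rw [div_eq_iff hp0] at hab
    rw [latticePoint]
    push_cast
    linear_combination hab
  have q2 : √3 < 1.7321 := (Real.sqrt_lt' (by norm_num)).2 (by norm_num)
  refine (pow_le_pow_iff_left₀ (norm_nonneg _) (by positivity) two_ne_zero).1 ?_
  rw [e, norm_mul, mul_pow, hp, sq_norm_add_mul_zeta, mul_pow, mul_assoc]
  refine mul_le_mul_of_nonneg_left ?_ (by positivity)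
  nlinarith

namespace IsSpecial

variable {r s : ℝ} {P : Set Disc}

theorem le_of_hasDisc (h : IsSpecial r s P) {c : ℂ} {ρ : ℝ} (hc : HasDisc P c ρ) : s ≤ ρ := by
  obtain ⟨d, hd, -, rfl⟩ := hc
  exact h.le_radius d hd

/-- A disc that is close to a large disc is one of its twelve small neighbors. -/
theorem eq_small_of_near (h : IsSpecial r s P) {x u c : ℂ} {ρ : ℝ} (hu : ‖u‖ = 1)
    (hx : IsHub P r s x u) (hc : HasDisc P c ρ) (hne : c ≠ x)
    (hnear : ‖c - x‖ ^ 2 + (1 + s) ^ 2 - 2 * ‖c - x‖ * (1 + s) * Real.cos (Real.pi / 12) <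
      (ρ + s) ^ 2) : ∃ j : ℕ, c = x + (1 + s) * (u * zeta ^ (2 * j)) := by
  have hD : 0 < ‖c - x‖ := norm_pos_iff.2 (sub_ne_zero.2 hne)
  have hDc : ((‖c - x‖ : ℝ) : ℂ) ≠ 0 := by exact_mod_cast hD.ne'
  have hu0 : u ≠ 0 := by rw [← norm_pos_iff, hu]; exact one_pos
  set w := (c - x) / ‖c - x‖ / u with hw
  have hw1 : ‖w‖ = 1 := by
    rw [hw, norm_div, norm_div, hu, Complex.norm_real, Real.norm_of_nonneg hD.le, div_one,
      div_self hD.ne']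
  have hcw : c - x = ‖c - x‖ * (u * w) := by rw [hw]; field_simp
  obtain ⟨j, hj⟩ := exists_cos_le_re w hw1
  refine ⟨j, ?_⟩
  by_contra hcon
  have h1 := hc.add_le_dist h.isCompactPacking.1 (h.hasDisc_small hu hx j) hcon
  have hρ := hc.radius_pos
  have hs := h.small_pos
  have h2 := pow_le_pow_left₀ (add_pos hρ hs).le h1 2
  have h3 := sq_norm_mul_sub_mul (w := u * zeta ^ (2 * j)) (w' := u * w)
    (by rw [norm_mul, hu, norm_zeta_pow, one_mul]) (by rw [norm_mul, hu, hw1, one_mul])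
    (1 + s) ‖c - x‖
  rw [conj_mul_mul_mul hu, ← hcw] at h3
  have e : c - (x + (1 + s) * (u * zeta ^ (2 * j))) =
      -(((1 + s : ℝ) : ℂ) * (u * zeta ^ (2 * j)) - (c - x)) := by push_cast; ring
  rw [e, norm_neg, h3] at h2
  have h4 : 0 < 2 * (1 + s) * ‖c - x‖ := by positivity
  nlinarith [mul_le_mul_of_nonneg_left hj h4.le]

theorem bounds_small (h : IsSpecial r s P) : 1 / 4 * (1 + s) < s ∧ s < 1 := by
  have hs := h.small_pos
  refine ⟨?_, h.small_lt.trans h.medium_lt⟩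
  have h1 := h.div_eq_cos
  rw [div_eq_iff (by positivity)] at h1
  nlinarith [cos_five_pi_div_twelve_bounds.1]

/-- There are no discs but the large ones of the lattice and their small neighbors. -/
theorem eq_latticePoint_or (h : IsSpecial r s P) {x u c : ℂ} {ρ : ℝ} (hu : ‖u‖ = 1)
    (hx : IsHub P r s x u) (hc : HasDisc P c ρ) : ∃ m n : ℤ,
      (c = latticePoint s x u m n ∧ ρ = 1) ∨
      (ρ = s ∧ ∃ j : ℕ, c = latticePoint s x u m n + (1 + s) * (u * zeta ^ (2 * j))) := by
  have hs := h.small_pos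
  obtain ⟨m, n, hmn⟩ := exists_latticePoint_near hs (x := x) hu c
  have hhub : IsHub P r s (latticePoint s x u m n) u := h.isHub_lattice hu hx m n
  refine ⟨m, n, ?_⟩
  by_cases hne : c = latticePoint s x u m n
  · refine .inl ⟨hne, ?_⟩
    rw [hne] at hc
    exact hc.radius_eq h.isCompactPacking.1 hhub.hasDisc
  · have h1 := hc.add_le_dist h.isCompactPacking.1 hhub.hasDisc hne
    have hρ := h.le_of_hasDisc hc
    obtain ⟨hs1, -⟩ := h.bounds_small
    have hc15 := cos_pi_div_twelve_gt
    obtain ⟨j, hj⟩ := h.eq_small_of_near hu hhub hc hne (by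
      set D := ‖c - latticePoint s x u m n‖
      have hD : 1 + s ≤ D := by linarith
      -- Between its bounds, D² is at most its chord. At both ends the left side of the goal is
      -- below (1+s)²/4, which is at most (ρ+s)².
      have h3 : (D - (1 + s)) * (D - (1 + s) * 1.2) ≤ 0 :=
        mul_nonpos_of_nonneg_of_nonpos (by linarith) (by linarith)
      have hD0 : 0 < D := by linarith
      have h4 : 0 < 2 * D * (1 + s) := by positivity
      have h5 : (1 / 2 * (1 + s)) ^ 2 ≤ (ρ + s) ^ 2 :=
        pow_le_pow_left₀ (by positivity) (by linarith) 2
      nlinarith [mul_lt_mul_of_pos_left hc15 h4])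
    refine .inr ⟨?_, j, hj⟩
    rw [hj] at hc
    exact hc.radius_eq h.isCompactPacking.1 (h.hasDisc_small hu hhub j)

theorem eq_small_of_tangent (h : IsSpecial r s P) {x u : ℂ} (hu : ‖u‖ = 1)
    (hx : IsHub P r s x u) {d e : Disc} (hd : d.center = x) (hd1 : d.radius = 1) (he : e ∈ P)
    (hde : d.Tangent e) :
    e.radius = s ∧ ∃ j : ℕ, e.center = x + (1 + s) * (u * zeta ^ (2 * j)) := by
  have hs := h.small_pos
  have hρ := h.le_radius e he
  have hD : ‖e.center - x‖ = 1 + e.radius := by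
    rw [← Complex.dist_eq, dist_comm, ← hd, ← hd1]; exact hde
  have hc : HasDisc P e.center e.radius := ⟨e, he, rfl, rfl⟩
  obtain ⟨hs1, hs2⟩ := h.bounds_small
  have hc15 := cos_pi_div_twelve_gt
  obtain ⟨j, hj⟩ := h.eq_small_of_near hu hx hc
    (by
      rintro h0
      rw [h0, sub_self, norm_zero] at hD
      linarith)
    (by
      -- As (1+ρ)² + (1+s)² = 2(1+ρ)(1+s) + (ρ−s)², the claim is 2(1+ρ)(1+s)(1 − cos(π/12)) < 4ρs.
      rw [hD]
      have hρ0 := e.radius_pos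
      have h4 : 0 < 2 * (1 + e.radius) * (1 + s) := by positivity
      have h5 : (1 / 3) * e.radius ≤ s * e.radius :=
        mul_le_mul_of_nonneg_right (by linarith) (by linarith)
      nlinarith [mul_lt_mul_of_pos_left hc15 h4])
  refine ⟨?_, j, hj⟩
  rw [hj] at hc
  exact hc.radius_eq h.isCompactPacking.1 (h.hasDisc_small hu hx j)

/-! ### The corona of a large disc and the structure of the packing. -/

theorem sq_dist_small (s : ℝ) {u : ℂ} (hu : ‖u‖ = 1) (x : ℂ) (i j : ℕ) :
    dist (x + (1 + s) * (u * zeta ^ (2 * i))) (x + (1 + s) * (u * zeta ^ (2 * j))) ^ 2 =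
      2 * (1 + s) ^ 2 * (1 - Real.cos ((i - j) * (Real.pi / 6))) := by
  have h1 := sq_norm_mul_sub_mul (w := u * zeta ^ (2 * i)) (w' := u * zeta ^ (2 * j))
    (by rw [norm_mul, hu, norm_zeta_pow, one_mul]) (by rw [norm_mul, hu, norm_zeta_pow, one_mul])
    (1 + s) (1 + s)
  rw [conj_mul_mul_mul hu, re_conj_zeta_pow_mul] at h1
  rw [Complex.dist_eq, add_sub_add_left_eq_sub]
  push_cast at h1
  rw [h1]
  have e : (2 * (i : ℝ) - 2 * j) * (Real.pi / 12) = (i - j) * (Real.pi / 6) := by ring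
  rw [e]
  ring

/-- Tangency of two of the twelve small discs seen from the large one at the angle π/6. -/
theorem four_mul_sq (h : IsSpecial r s P) :
    (s + s) ^ 2 = 2 * (1 + s) ^ 2 * (1 - Real.cos (Real.pi / 6)) := by
  have hs := h.small_pos
  have h1 := h.div_eq_cos
  rw [div_eq_iff (by positivity)] at h1
  have h2 : Real.cos (Real.pi / 6) = 1 - 2 * Real.cos (5 * Real.pi / 12) ^ 2 := by
    rw [Real.cos_sq]
    have : 2 * (5 * Real.pi / 12) = Real.pi - Real.pi / 6 := by ring
    rw [this, Real.cos_pi_sub]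
    ring
  rw [h2]
  nth_rewrite 1 2 [h1]
  ring

theorem cos_eq_cos_pi_div_six_iff (k : ℤ) : Real.cos (k * (Real.pi / 6)) = Real.cos (Real.pi / 6) ↔
    ∃ l : ℤ, k = 12 * l + 1 ∨ k = 12 * l - 1 := by
  have hpi := Real.pi_pos
  rw [eq_comm, Real.cos_eq_cos_iff]
  refine exists_congr fun l => or_congr ?_ ?_
  · rw [show (k : ℝ) * (Real.pi / 6) = 2 * l * Real.pi + Real.pi / 6 ↔
      (k : ℝ) * (Real.pi / 6) = (12 * l + 1) * (Real.pi / 6) by ring_nf,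
      mul_left_inj' (by positivity)]
    exact_mod_cast Iff.rfl
  · rw [show (k : ℝ) * (Real.pi / 6) = 2 * l * Real.pi - Real.pi / 6 ↔
      (k : ℝ) * (Real.pi / 6) = (12 * l - 1) * (Real.pi / 6) by ring_nf,
      mul_left_inj' (by positivity)]
    exact_mod_cast Iff.rfl

/-- The corona of a large disc of the lattice. -/
theorem hasCorona_replicate (h : IsSpecial r s P) {x u : ℂ} (hu : ‖u‖ = 1)
    (hx : IsHub P r s x u) {d : Disc} (hd : d.center = x) (hd1 : d.radius = 1) :
    HasCorona r s P d (List.replicate 12 .small) := by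
  have hpi := Real.pi_pos
  have hs := h.small_pos
  have hpow : ∀ j : ℕ, zeta ^ (2 * j) = zeta ^ (2 * (j % 12)) := by
    intro j
    have h24 : zeta ^ 24 = 1 := by linear_combination (zeta ^ 12 - 1) * zeta_pow_twelve
    conv_lhs => rw [← Nat.div_add_mod j 12]
    rw [mul_add, ← mul_assoc, pow_add, pow_mul, show 2 * 12 = 24 from rfl, h24, one_pow, one_mul]
  refine ⟨fun i => ⟨x + (1 + s) * (u * zeta ^ (2 * i.val)), s, hs⟩, ?_, ?_, ?_, ?_⟩
  · intro i j hij
    have hi := i.isLt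
    have hj := j.isLt
    simp only [List.length_replicate] at hi hj
    simp only [Disc.mk.injEq, and_true] at hij
    have h1 := sq_dist_small s hu x i.val j.val
    rw [hij, dist_self] at h1
    have h2 : Real.cos (((i.val : ℝ) - j.val) * (Real.pi / 6)) = 1 := by
      have : 0 < 2 * (1 + s) ^ 2 := by positivity
      have h3 : 2 * (1 + s) ^ 2 * (1 - Real.cos (((i.val : ℝ) - j.val) * (Real.pi / 6))) = 0 := by
        linarith
      have := (mul_eq_zero.1 h3).resolve_left this.ne'
      linarith
    obtain ⟨n, hn⟩ := (Real.cos_eq_one_iff _).1 h2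
    have h4 : ((12 * n : ℤ) : ℝ) = (((i.val : ℤ) - (j.val : ℤ) : ℤ) : ℝ) := by
      push_cast
      have h6 : (12 * (n : ℝ)) * (Real.pi / 6) = ((i.val : ℝ) - j.val) * (Real.pi / 6) := by
        linarith
      exact mul_right_cancel₀ (by positivity) h6
    have h5 : 12 * n = (i.val : ℤ) - j.val := by exact_mod_cast h4
    exact Fin.ext (by omega)
  · ext e
    simp only [Set.mem_range, Set.mem_ofPred_eq]
    constructor
    · rintro ⟨i, rfl⟩
      obtain ⟨e, he, hec, her⟩ := h.hasDisc_small hu hx i.val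
      obtain rfl : e = ⟨x + (1 + s) * (u * zeta ^ (2 * i.val)), s, hs⟩ :=
        Disc.eq_of_center_radius hec her
      refine ⟨he, ?_⟩
      unfold Disc.Tangent
      rw [hd, hd1, Complex.dist_eq, sub_add_cancel_left, norm_neg, norm_mul, norm_mul, hu,
        norm_zeta_pow, one_mul, mul_one, ← Complex.ofReal_one, ← Complex.ofReal_add,
        Complex.norm_real, Real.norm_of_nonneg (by positivity)]
    · rintro ⟨he, hde⟩
      obtain ⟨her, j, hj⟩ := h.eq_small_of_tangent hu hx hd hd1 he hde
      refine ⟨⟨j % 12, ?_⟩, ?_⟩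
      · rw [List.length_replicate]; exact Nat.mod_lt _ (by norm_num)
      · refine Disc.eq_of_center_radius ?_ her.symm
        rw [hj, hpow j]
  · intro i
    rw [List.get_eq_getElem, List.getElem_replicate]
    rfl
  · intro i j hij
    have hi := i.isLt
    have hj := j.isLt
    simp only [List.length_replicate] at hi hj ⊢
    have hij' : i.val ≠ j.val := fun h0 => hij (Fin.ext h0)
    unfold Disc.Tangent
    have h1 := sq_dist_small s hu x i.val j.val
    have h2 := h.four_mul_sq
    have h3 : ((i.val : ℝ) - j.val) * (Real.pi / 6) =
        (((i.val : ℤ) - (j.val : ℤ) : ℤ) : ℝ) * (Real.pi / 6) := by push_cast; ring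
    rw [h3] at h1
    have h4 := cos_eq_cos_pi_div_six_iff ((i.val : ℤ) - j.val)
    have h5 : 0 < 2 * (1 + s) ^ 2 := by positivity
    rw [← pow_left_inj₀ dist_nonneg (by positivity) two_ne_zero, h1, h2, mul_right_inj' h5.ne',
      sub_right_inj, h4]
    constructor
    · rintro ⟨l, hl | hl⟩ <;> omega
    -- A nonzero multiple of 12 occurs only at the seam between the positions 11 and 0.
    · rintro (h0 | h0)
      · by_cases h6 : j.val = 0
        · exact ⟨1, by omega⟩
        · exact ⟨0, by omega⟩
      · by_cases h6 : i.val = 0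
        · exact ⟨-1, by omega⟩
        · exact ⟨0, by omega⟩

/-- A packing which contains a good disc is determined. -/
theorem structure_of_isHub (h : IsSpecial r s P) {x u : ℂ} (hu : ‖u‖ = 1)
    (hx : IsHub P r s x u) :
    IsTriangularGrid {y | ∃ d ∈ P, d.radius = 1 ∧ y = d.center} ∧
      (∀ d ∈ P, d.radius = 1 → HasCorona r s P d (List.replicate 12 .small)) ∧
      (∀ d ∈ P, d.radius = 1 ∨ (d.radius = s ∧ ∃ e ∈ P, e.radius = 1 ∧ d.Tangent e)) ∧
      ∀ d ∈ P, d.radius ≠ r := by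
  have hs := h.small_pos
  have hsr := h.small_lt
  have hr := h.medium_lt
  have hhub : ∀ m n, IsHub P r s (latticePoint s x u m n) u := fun m n => h.isHub_lattice hu hx m n
  have hall : ∀ d ∈ P, ∃ m n : ℤ, (d.center = latticePoint s x u m n ∧ d.radius = 1) ∨
      (d.radius = s ∧ ∃ j : ℕ,
        d.center = latticePoint s x u m n + (1 + s) * (u * zeta ^ (2 * j))) :=
    fun d hd => h.eq_latticePoint_or hu hx ⟨d, hd, rfl, rfl⟩
  have hlarge : ∀ d ∈ P, d.radius = 1 → ∃ m n : ℤ, d.center = latticePoint s x u m n := by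
    intro d hd hd1
    obtain ⟨m, n, h1 | h1⟩ := hall d hd
    · exact ⟨m, n, h1.1⟩
    · linarith [h1.1]
  refine ⟨⟨x, latticeVector s u, latticeVector s u * zeta ^ 4, ?_, ?_, ?_, ?_⟩, ?_, ?_, ?_⟩
  · exact latticeVector_ne_zero hs hu
  · rw [norm_mul, norm_zeta_pow, mul_one]
  · have : latticeVector s u - latticeVector s u * zeta ^ 4 =
        -(latticeVector s u * zeta ^ 8) := by
      linear_combination latticeVector s u * zeta_pow_eight
    rw [this, norm_neg, norm_mul, norm_zeta_pow, mul_one]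
  · ext y
    constructor
    · rintro ⟨d, hd, hd1, rfl⟩
      exact hlarge d hd hd1
    · rintro ⟨m, n, rfl⟩
      obtain ⟨d, hd, hdc, hdr⟩ := (hhub m n).hasDisc
      exact ⟨d, hd, hdr, hdc.symm⟩
  · intro d hd hd1
    obtain ⟨m, n, hmn⟩ := hlarge d hd hd1
    exact h.hasCorona_replicate hu (hhub m n) hmn hd1
  · intro d hd
    obtain ⟨m, n, h1 | ⟨h1, j, hj⟩⟩ := hall d hd
    · exact .inl h1.2
    · obtain ⟨e, he, hec, her⟩ := (hhub m n).hasDisc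
      refine .inr ⟨h1, e, he, her, ?_⟩
      unfold Disc.Tangent
      rw [hj, hec, her, h1, Complex.dist_eq, add_sub_cancel_left, norm_mul, norm_mul, hu,
        norm_zeta_pow, one_mul, mul_one, ← Complex.ofReal_one, ← Complex.ofReal_add,
        Complex.norm_real, Real.norm_of_nonneg (by positivity), add_comm]
  · intro d hd
    obtain ⟨m, n, h1 | h1⟩ := hall d hd
    · rw [h1.2]; exact hr.ne'
    · rw [h1.1]; exact hsr.ne

end IsSpecial

/-! ### From coronas in a packing to their equations. -/

theorem hasDisc_center {P : Set Disc} {d e : Disc} (he : e ∈ P) : HasDisc P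
    (d.center + (d.radius + e.radius) * ((e.center - d.center) / (d.radius + e.radius)))
    e.radius :=
  ⟨e, he, d.center_eq e, rfl⟩

theorem exists_eq_mul_rot_of_tangent {d e f : Disc} (hde : d.Tangent e) (hdf : d.Tangent f)
    (hef : e.Tangent f) : ∃ σ : ℝ, (σ = 1 ∨ σ = -1) ∧
      (f.center - d.center) / (d.radius + f.radius) =
        (e.center - d.center) / (d.radius + e.radius) *
          rot σ (discAngle e.radius d.radius f.radius) := by
  have h := eq_mul_exp_of_tangent hde hdf hef
  rcases le_total 0 ((starRingEnd ℂ) (e.center - d.center) * (f.center - d.center)).im with h0 | h0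
  · exact ⟨1, .inl rfl, h.1 h0⟩
  · exact ⟨-1, .inr rfl, h.2 h0⟩

/-- Consecutive neighbors of a smallest disc turn around it in the same sense. -/
theorem sense_eq {P : Set Disc} (hP : IsPacking P) {d e f g : Disc}
    (hmin : ∀ c ∈ P, d.radius ≤ c.radius) (he : e ∈ P) (hf : f ∈ P) (hg : g ∈ P)
    (hde : d.Tangent e) (hdg : d.Tangent g) (hne : e ≠ g) {σ σ' : ℝ}
    (hσ : σ = 1 ∨ σ = -1) (hσ' : σ' = 1 ∨ σ' = -1)
    (h1 : (f.center - d.center) / (d.radius + f.radius) =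
      (e.center - d.center) / (d.radius + e.radius) * rot σ (discAngle e.radius d.radius f.radius))
    (h2 : (g.center - d.center) / (d.radius + g.radius) =
      (f.center - d.center) / (d.radius + f.radius) *
        rot σ' (discAngle f.radius d.radius g.radius)) : σ' = σ := by
  -- With opposite senses, e and g would be seen at the angle |α − β|, smaller than the angle γ of
  -- tangent discs by `discAngle_lt_add`.
  by_contra hcon
  have hσσ : σ' = -σ := by
    rcases hσ with rfl | rfl <;> rcases hσ' with rfl | rfl <;> simp_all
  subst hσσ
  have hd0 := d.radius_pos
  have hw := norm_eq_one_of_tangent hde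
  have hcenter : e.center ≠ g.center := by
    intro h0
    have := hP.radius_add_le_dist he hg hne
    rw [h0, dist_self] at this
    linarith [e.radius_pos, g.radius_pos]
  have h3 := re_le_cos_discAngle hP hw (norm_eq_one_of_tangent hdg) hd0
    (hasDisc_center he) (hasDisc_center hg)
    (by rwa [← Disc.center_eq, ← Disc.center_eq])
  set α := discAngle e.radius d.radius f.radius with hα
  set β := discAngle f.radius d.radius g.radius with hβ
  set γ := discAngle e.radius d.radius g.radius with hγ
  have e1 : (g.center - d.center) / (d.radius + g.radius) =
      (e.center - d.center) / (d.radius + e.radius) *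
        Complex.exp ((σ * (α - β) : ℝ) * Complex.I) := by
    rw [h2, h1, mul_assoc, rot, rot, ← Complex.exp_add]
    congr 2
    push_cast
    ring
  rw [e1, conj_mul_mul_exp hw, Complex.exp_ofReal_mul_I_re] at h3
  have e2 : Real.cos (σ * (α - β)) = Real.cos |α - β| := by
    rw [Real.cos_abs]
    rcases hσ with rfl | rfl
    · rw [one_mul]
    · rw [neg_one_mul, Real.cos_neg]
  have h4 : α < γ + β := by
    rw [hα, hβ, discAngle_comm f.radius]
    exact discAngle_lt_add hd0 (hmin e he) (hmin f hf) (hmin g hg)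
  have h5 : β < α + γ := by
    rw [hα, discAngle_comm e.radius]
    exact discAngle_lt_add hd0 (hmin f hf) (hmin g hg) (hmin e he)
  have h6 : |α - β| < γ := abs_lt.2 ⟨by linarith, by linarith⟩
  have h7 := Real.cos_lt_cos_of_nonneg_of_le_pi (abs_nonneg _) (discAngle_le_pi _ _ _) h6
  rw [e2] at h3
  linarith

/-- The angles of a corona of five discs add up to a multiple of `2 * π`. -/
theorem exists_sum_discAngle_eq {P : Set Disc} (hP : IsPacking P) {d : Disc}
    (hmin : ∀ c ∈ P, d.radius ≤ c.radius) (f : Fin 5 → Disc) (hf : Function.Injective f)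
    (hfP : ∀ i, f i ∈ P ∧ d.Tangent (f i)) (htan : ∀ i, (f i).Tangent (f (i + 1))) :
    ∃ n : ℤ, ∑ i, discAngle (f i).radius d.radius (f (i + 1)).radius = n * (2 * Real.pi) := by
  choose σ hσ hrot using fun i =>
    exists_eq_mul_rot_of_tangent (hfP i).2 (hfP (i + 1)).2 (htan i)
  have hstep : ∀ i, σ (i + 1) = σ i := fun i =>
    sense_eq hP hmin (hfP i).1 (hfP (i + 1)).1 (hfP (i + 1 + 1)).1 (hfP i).2 (hfP (i + 1 + 1)).2
      (hf.ne (by revert i; decide)) (hσ i) (hσ (i + 1)) (hrot i) (hrot (i + 1))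
  have h1 : σ 1 = σ 0 := hstep 0
  have h2 : σ 2 = σ 0 := (hstep 1).trans h1
  have h3 : σ 3 = σ 0 := (hstep 2).trans h2
  have h4 : σ 4 = σ 0 := (hstep 3).trans h3
  have r0 := hrot 0
  have r1 := hrot 1
  have r2 := hrot 2
  have r3 := hrot 3
  have r4 := hrot 4
  rw [h1] at r1
  rw [h2] at r2
  rw [h3] at r3
  rw [h4] at r4
  simp only [Fin.isValue, Fin.reduceAdd, zero_add] at r0 r1 r2 r3 r4
  set α : Fin 5 → ℝ := fun i => discAngle (f i).radius d.radius (f (i + 1)).radius with hα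
  have hw := norm_eq_one_of_tangent (hfP 0).2
  have hloop : rot (σ 0) (∑ i, α i) = 1 := by
    rw [Fin.sum_univ_five, rot_add, rot_add, rot_add, rot_add]
    rw [r3, r2, r1, r0] at r4
    have hw0 : (f 0).center - d.center ≠ 0 ∧ ((d.radius : ℂ) + (f 0).radius) ≠ 0 := by
      rw [← div_ne_zero_iff, ← norm_pos_iff, hw]; exact one_pos
    refine mul_left_cancel₀ (div_ne_zero hw0.1 hw0.2) ?_
    rw [mul_one]
    simp only [← mul_assoc]
    exact r4.symm
  have hcos : Real.cos (∑ i, α i) = 1 := by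
    have := congrArg Complex.re hloop
    rw [rot, Complex.exp_ofReal_mul_I_re, Complex.one_re] at this
    rcases hσ 0 with h0 | h0
    · rwa [h0, one_mul] at this
    · rwa [h0, neg_one_mul, Real.cos_neg] at this
  obtain ⟨n, hn⟩ := (Real.cos_eq_one_iff _).1 hcos
  exact ⟨n, hn.symm⟩

/-- Going through a corona could a priori mean several turns; crude bounds on the angles leave one.
-/
theorem eq_two_pi_of_bounds {x : ℝ} (h : ∃ n : ℤ, x = n * (2 * Real.pi)) (h0 : 0 < x)
    (h1 : x < 4 * Real.pi) : x = 2 * Real.pi := by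
  have hpi := Real.pi_pos
  obtain ⟨n, rfl⟩ := h
  have h2 : (0 : ℝ) < n := pos_of_mul_pos_left h0 (by positivity)
  have h3 : (n : ℝ) < 2 := by nlinarith
  have h4 : n = 1 := by
    have h5 : 0 < n := by exact_mod_cast h2
    have h6 : n < 2 := by exact_mod_cast h3
    omega
  rw [h4]
  push_cast
  ring

theorem discAngle_self_right_bounds {s x : ℝ} (hs : 0 < s) (hx : s ≤ x) :
    Real.pi / 3 ≤ discAngle x s s ∧ discAngle x s s < Real.pi / 2 := by
  constructor
  · rw [← discAngle_self hs]; exact discAngle_le_discAngle hs hs hs hx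
  · have hx0 : 0 < x := hs.trans_le hx
    rw [discAngle_self_right hx0 hs, Real.arccos_lt_pi_div_two]
    positivity

section Corona

variable {r s : ℝ} {P : Set Disc}

theorem HasSizes.le_radius (hsr : s < r) (hr : r < 1) (h : HasSizes r s P) :
    ∀ d ∈ P, s ≤ d.radius := by
  intro d hd
  obtain ⟨x, hx⟩ := h d hd
  rw [hx]
  exact x.le_radius hsr hr

theorem HasCorona.exists_fin_five {d : Disc} {a₀ a₁ a₂ a₃ a₄ : Size}
    (h : HasCorona r s P d [a₀, a₁, a₂, a₃, a₄]) : ∃ f : Fin 5 → Disc, Function.Injective f ∧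
      (∀ i, f i ∈ P ∧ d.Tangent (f i)) ∧ (∀ i, (f i).Tangent (f (i + 1))) ∧
      (f 0).radius = a₀.radius r s ∧ (f 1).radius = a₁.radius r s ∧
      (f 2).radius = a₂.radius r s ∧ (f 3).radius = a₃.radius r s ∧
      (f 4).radius = a₄.radius r s := by
  obtain ⟨f, hinj, hrange, hrad, htan⟩ := h
  have h1 : ∀ i : Fin 5, i ≠ i + 1 := by decide
  have h2 : ∀ i : Fin 5, (i.val + 1) % 5 = (i + 1).val := by decide
  refine ⟨f, hinj, fun i => ?_, fun i => (htan i (i + 1) (h1 i)).2 (.inl (h2 i)),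
    hrad 0, hrad 1, hrad 2, hrad 3, hrad 4⟩
  have : f i ∈ Set.range f := ⟨i, rfl⟩
  rw [hrange] at this
  exact this

theorem ContainsSmallCorona.exists_sum_eq (hsr : s < r) (hr : r < 1)
    (hP : IsPacking P) (hsz : HasSizes r s P) {a₀ a₁ a₂ a₃ a₄ : Size}
    (h : ContainsSmallCorona r s P [a₀, a₁, a₂, a₃, a₄]) :
    ∃ n : ℤ, smallAngleSum r s [a₀, a₁, a₂, a₃, a₄] = n * (2 * Real.pi) := by
  obtain ⟨d, hd, hds, hc⟩ := h
  obtain ⟨f, hinj, hfP, htan, e0, e1, e2, e3, e4⟩ := hc.exists_fin_five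
  have hmin : ∀ c ∈ P, d.radius ≤ c.radius := by
    rw [hds]; exact hsz.le_radius hsr hr
  obtain ⟨n, hn⟩ := exists_sum_discAngle_eq hP hmin f hinj hfP htan
  refine ⟨n, ?_⟩
  rw [← hn, Fin.sum_univ_five]
  simp only [Fin.isValue, Fin.reduceAdd, zero_add, e0, e1, e2, e3, e4, hds]
  simp [smallAngleSum, add_assoc]

theorem ContainsSmallCorona.satisfies_w1s1ss (hs : 0 < s) (hsr : s < r) (hr : r < 1)
    (hP : IsPacking P) (hsz : HasSizes r s P) (h : ContainsSmallCorona r s P w1s1ss) :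
    SatisfiesSmallCorona r s w1s1ss := by
  have hpi := Real.pi_pos
  obtain ⟨h1, h2⟩ := discAngle_self_right_bounds hs (hsr.trans hr).le
  have e := smallAngleSum_w1s1ss (r := r) hs
  refine eq_two_pi_of_bounds (ContainsSmallCorona.exists_sum_eq hsr hr hP hsz h) ?_ ?_ <;>
    rw [e] <;> linarith

theorem ContainsSmallCorona.satisfies_w1srrs (hs : 0 < s) (hsr : s < r) (hr : r < 1)
    (hP : IsPacking P) (hsz : HasSizes r s P) (h : ContainsSmallCorona r s P w1srrs) :
    SatisfiesSmallCorona r s w1srrs := by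
  have hpi := Real.pi_pos
  obtain ⟨h1, h2⟩ := discAngle_self_right_bounds hs (hsr.trans hr).le
  obtain ⟨h3, h4⟩ := discAngle_self_right_bounds hs hsr.le
  have h5 := discAngle_nonneg r s r
  have h6 := discAngle_le_pi r s r
  have e := smallAngleSum_w1srrs r s
  refine eq_two_pi_of_bounds (ContainsSmallCorona.exists_sum_eq hsr hr hP hsz h) ?_ ?_ <;>
    rw [e] <;> linarith

theorem IsSpecial.exists_isHub (h : IsSpecial r s P) (hc : ContainsSmallCorona r s P w1s1ss) :
    ∃ x u : ℂ, ‖u‖ = 1 ∧ IsHub P r s x u := by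
  obtain ⟨d, hd, hds, hc⟩ := hc
  obtain ⟨f, hinj, hfP, htan, e0, e1, e2, -, -⟩ := HasCorona.exists_fin_five hc
  simp only [Size.radius] at e0 e1 e2
  have t01 : (f 0).Tangent (f 1) := htan 0
  have t12 : (f 1).Tangent (f 2) := htan 1
  have hA : discAngle 1 s s = 5 * Real.pi / 12 :=
    (satisfiesSmallCorona_w1s1ss_iff h.small_pos).1 h.equation_w1s1ss
  obtain ⟨σ, hσ, r1⟩ := exists_eq_mul_rot_of_tangent (hfP 0).2 (hfP 1).2 t01
  obtain ⟨σ', hσ', r2⟩ := exists_eq_mul_rot_of_tangent (hfP 1).2 (hfP 2).2 t12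
  have hmin : ∀ c ∈ P, d.radius ≤ c.radius := by rw [hds]; exact h.le_radius
  obtain rfl : σ' = σ := sense_eq h.isCompactPacking.1 hmin (hfP 0).1 (hfP 1).1 (hfP 2).1
    (hfP 0).2 (hfP 2).2 (hinj.ne (by decide)) hσ hσ' r1 r2
  have n0 := norm_eq_one_of_tangent (hfP 0).2
  have n2 := norm_eq_one_of_tangent (hfP 2).2
  have c0 := Disc.center_eq d (f 0)
  have c1 := Disc.center_eq d (f 1)
  have c2 := Disc.center_eq d (f 2)
  rw [e0, e1, hds] at r1
  rw [e1, e2, hds, discAngle_comm] at r2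
  rw [hds, e0] at n0 c0
  rw [hds, e1] at c1
  rw [hds, e2] at n2 c2
  rw [hA] at r1 r2
  have hz : HasDisc P d.center s := ⟨d, hd, rfl, hds⟩
  set w0 := ((f 0).center - d.center) / ((s : ℂ) + (1 : ℝ))
  set w1 := ((f 1).center - d.center) / ((s : ℂ) + s)
  set w2 := ((f 2).center - d.center) / ((s : ℂ) + (1 : ℝ))
  have m0 : Nbr P r s d.center w0 .large :=
    ⟨f 0, (hfP 0).1, by rw [c0]; simp only [Size.radius]; push_cast; rfl, e0⟩
  have m1 : Nbr P r s d.center w1 .small :=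
    ⟨f 1, (hfP 1).1, by rw [c1]; simp only [Size.radius]; push_cast; rfl, e1⟩
  have m2 : Nbr P r s d.center w2 .large :=
    ⟨f 2, (hfP 2).1, by rw [c2]; simp only [Size.radius]; push_cast; rfl, e2⟩
  suffices ∃ u, ‖u‖ = 1 ∧ IsGood P r s d.center u by
    obtain ⟨u, hu, hg⟩ := this
    exact ⟨d.center + (1 + s) * u, u, hu, hg.congr (by ring) rfl⟩
  have r5 : rot 1 (5 * Real.pi / 12) = zeta ^ 5 := rot_one_eq_zeta_pow 5 (by push_cast; ring)
  have r19 : rot (-1) (5 * Real.pi / 12) * zeta ^ 5 = 1 := by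
    rw [← r5, rot, rot, ← Complex.exp_add]
    simp
  -- If the three discs 1s1 turn clockwise, they are read from the third one: the word is a
  -- palindrome.
  rcases hσ' with rfl | rfl
  · rw [r5] at r1 r2
    refine ⟨w0, n0, h.isGood_of_nbr n0 hz m0 (r1 ▸ m1) ?_⟩
    have : w0 * zeta ^ 10 = w2 := by rw [r2, r1]; ring
    rw [this]
    exact m2
  · have k1 : w2 * zeta ^ 5 = w1 := by rw [r2, mul_assoc, r19, mul_one]
    have k0 : w2 * zeta ^ 10 = w0 := by
      have : w2 * zeta ^ 10 = w2 * zeta ^ 5 * zeta ^ 5 := by ring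
      rw [this, k1, r1, mul_assoc, r19, mul_one]
    refine ⟨w2, n2, h.isGood_of_nbr n2 hz m2 ?_ ?_⟩
    · rw [k1]; exact m1
    · rw [k0]; exact m0

end Corona

end DiscPacking

theorem mainTheorem2 :
    -- the two small coronas determine the radii
    (∃! p : ℝ × ℝ, (0 < p.2 ∧ p.2 < p.1 ∧ p.1 < 1) ∧
      DiscPacking.SatisfiesSmallCorona p.1 p.2 DiscPacking.w1srrs ∧
      DiscPacking.SatisfiesSmallCorona p.1 p.2 DiscPacking.w1s1ss) ∧
    -- no compact packing contains both small coronas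
    (∀ r s : ℝ, 0 < s → s < r → r < 1 →
      ∀ P : Set DiscPacking.Disc,
        DiscPacking.IsCompactPacking P → DiscPacking.HasSizes r s P →
        ¬ (DiscPacking.ContainsSmallCorona r s P DiscPacking.w1srrs ∧
            DiscPacking.ContainsSmallCorona r s P DiscPacking.w1s1ss)) ∧
    -- for these radii, the small corona 1s1ss forces the packing
    (∀ r s : ℝ, 0 < s → s < r → r < 1 →
      DiscPacking.SatisfiesSmallCorona r s DiscPacking.w1srrs →
      DiscPacking.SatisfiesSmallCorona r s DiscPacking.w1s1ss →
      ∀ P : Set DiscPacking.Disc,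
        DiscPacking.IsCompactPacking P → DiscPacking.HasSizes r s P →
        DiscPacking.ContainsSmallCorona r s P DiscPacking.w1s1ss →
        DiscPacking.IsTriangularGrid {x | ∃ d ∈ P, d.radius = 1 ∧ x = d.center} ∧
        (∀ d ∈ P, d.radius = 1 →
          DiscPacking.HasCorona r s P d (List.replicate 12 DiscPacking.Size.small)) ∧
        (∀ d ∈ P, d.radius = 1 ∨
          (d.radius = s ∧ ∃ e ∈ P, e.radius = 1 ∧ d.Tangent e)) ∧
        ∀ d ∈ P, d.radius ≠ r) := by
  refine ⟨DiscPacking.existsUnique_radii, ?_, ?_⟩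
  · rintro r s hs hsr hr P hP hsz ⟨h1, h2⟩
    have h : DiscPacking.IsSpecial r s P := ⟨hs, hsr, hr, h1.satisfies_w1srrs hs hsr hr hP.1 hsz,
      h2.satisfies_w1s1ss hs hsr hr hP.1 hsz, hP, hsz⟩
    obtain ⟨x, u, hu, hx⟩ := h.exists_isHub h2
    obtain ⟨d, -, -, hc⟩ := h1
    obtain ⟨f, -, hfP, -, -, -, h3, -⟩ := DiscPacking.HasCorona.exists_fin_five hc
    -- The third letter of 1srrs is a medium disc.
    exact (h.structure_of_isHub hu hx).2.2.2 (f 2) (hfP 2).1 h3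
  · intro r s hs hsr hr h1 h2 P hP hsz hc
    have h : DiscPacking.IsSpecial r s P := ⟨hs, hsr, hr, h1, h2, hP, hsz⟩
    obtain ⟨x, u, hu, hx⟩ := h.exists_isHub hc
    exact h.structure_of_isHub hu hx
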